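/- Let $\mathcal E$ be a finite metric space, let $\lambda,\kappa,\mu\colon\mathcal E\to[0,\infty)$ and fix $t\ge 0$. For a càdlàg process $J=(J(s))_{s\ge0}$ in $\mathcal E$ (the background process), the modulated infinite-server queue $(J,\lambda,\kappa,\mu)$ is defined as follows. Let $\bar\tau_1<\bar\tau_2<\cdots$ be the jump times of a standard Poisson process (partial sums of i.i.d. standard exponential variables) and let $\bar Z_1,\bar Z_2,\dots$ be i.i.d. standard exponential variables, with $J$, $(\bar\tau_k)_k$, $(\bar Z_k)_k$ independent. Job $k$ arrives at time $\tau_k=\inf\{s\ge0:\int_0^s\lambda(J(r))\,dr\ge\bar\tau_k\}$ (with $\inf\emptyset=\infty$), has service requirement $Z_k=\bar Z_k/\kappa(J(\tau_k))$ ($=\infty$ if $\kappa(J(\tau_k))=0$), and is in the system at time $t$ if and only if $\tau_k\le t$ and $Z_k>\int_{\tau_k}^t\mu(J(r))\,dr$. For $n\ge 1$ let $M_n(t)$ be the number of jobs in the system at time $t$ for the queue $(J,n\lambda,\kappa,\mu)$. Put $$\phi_t(J)=\int_0^t\lambda(J(s))\,e^{-\kappa(J(s))\int_s^t\mu(J(r))\,dr}\,ds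 ,$$ let $\nu_n$ be the law of $\phi_t(J)$ for every $n$, let $\mathcal R(t)$ be the set of attainable parameters, i.e. of all $\gamma\ge0$ such that for every $\epsilon>0$, $\nu_n((\gamma-\epsilon,\gamma+\epsilon))>0$ for all sufficiently large $n$, and let $\ell(\gamma;a)=\sup_{\theta\in\mathbb R}[\theta a-\gamma(e^\theta-1)]$ be the Fenchel–Legendre transform of the cumulant generating function of the Poisson distribution with parameter $\gamma$. A sequence of probability measures $(\tau_n)$ on $\mathbb R$ satisfies the large deviations principle (LDP) with rate function $\rho\colon\mathbb R\to[0,\infty]$ if $\rho$ is lower semicontinuous, $\limsup_n\frac1n\log\tau_n(F)\le-\inf_F\rho$ for all closed $F$ and $\liminf_n\frac1n\log\tau_n(G)\ge-\inf_G\rho$ for all open $G$. The rate function is good if $\{\rho\le c\}$ is compact for every $c\in[0,\infty)$. Let $J^{(1)}$ be any càdlàg process with values in $\mathcal E$ and let $J^{(2)}$ be an irreducible continuous-time (time-homogeneous, càdlàg) Markov chain with state space $\mathcal E$ and arbitrary initial distribution. Write $\nu_n^{(i)}$, $\mathcal R^{(i)}(t)$, $M^{(i)}_n(t)$ for the objects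 above with $J=J^{(i)}$. Then for $i=1,2$ the sequence $(\nu_n^{(i)})_n$ satisfies an LDP with some rate function; whenever it does so with rate function $\psi^{(i)}$, the laws of $\frac1nM_n^{(i)}(t)$ satisfy the LDP with rate function $$I^{(i)}(a)=\inf_{\gamma\in\mathcal R^{(i)}(t)}\left[\ell(\gamma;a)+\psi^{(i)}(\gamma)\right].$$ Moreover $I^{(1)}(a)\ge I^{(2)}(a)$ for all $a\in\mathbb R$, and both $I^{(1)}$ and $I^{(2)}$ are good rate functions. -/

import Mathlib

open MeasureTheory ProbabilityTheory Filter Topology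
open scoped NNReal ENNReal

noncomputable section

namespace ModulatedQueue

/-! ### Large deviations -/

/-- A rate function: a lower semicontinuous function with values in `[0, ∞]`. -/
def IsRateFunction {X : Type*} [TopologicalSpace X] (ρ : X → ℝ≥0∞) : Prop :=
  LowerSemicontinuous ρ

/-- A good rate function: a rate function all of whose (finite) level sets are compact. -/
def IsGoodRateFunction {X : Type*} [TopologicalSpace X] (ρ : X → ℝ≥0∞) : Prop :=
  IsRateFunction ρ ∧ ∀ c : ℝ≥0, IsCompact {x | ρ x ≤ c}

/-- The sequence of measures `τ n` satisfies the large deviations principle (with speed `n`) with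
rate function `ρ`. The logarithm is `EReal`-valued, with `log 0 = -∞`. -/
structure SatisfiesLDP {X : Type*} [TopologicalSpace X] [MeasurableSpace X]
    (τ : ℕ → Measure X) (ρ : X → ℝ≥0∞) : Prop where
  isRateFunction : IsRateFunction ρ
  upper : ∀ F : Set X, IsClosed F →
    limsup (fun n : ℕ => ((1 / (n : ℝ) : ℝ) : EReal) * ENNReal.log (τ n F)) atTop
      ≤ -((⨅ a ∈ F, ρ a : ℝ≥0∞) : EReal)
  lower : ∀ G : Set X, IsOpen G →
    -((⨅ a ∈ G, ρ a : ℝ≥0∞) : EReal)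
      ≤ liminf (fun n : ℕ => ((1 / (n : ℝ) : ℝ) : EReal) * ENNReal.log (τ n G)) atTop

/-! ### Background processes -/

/-- Right-continuous with left limits (the condition on left limits is void at time `0`). -/
def IsCadlag {E : Type*} [TopologicalSpace E] (f : ℝ≥0 → E) : Prop :=
  ∀ t, ContinuousWithinAt f (Set.Ici t) t ∧ ∃ x, Tendsto f (𝓝[<] t) (𝓝 x)

/-- A background process: a stochastic process in `E` with càdlàg paths. -/
structure IsBackgroundProcess {Ω E : Type*} [MeasurableSpace Ω] [TopologicalSpace E]
    [MeasurableSpace E] (J : ℝ≥0 → Ω → E) : Prop where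
  measurable : ∀ s, Measurable (J s)
  cadlag : ∀ ω, IsCadlag (fun s => J s ω)

/-- `Q` is the transition rate matrix of a continuous-time Markov chain on a finite set. -/
structure IsRateMatrix {E : Type*} [Fintype E] (Q : Matrix E E ℝ) : Prop where
  nonneg : ∀ x y, x ≠ y → 0 ≤ Q x y
  row_sum : ∀ x, ∑ y, Q x y = 0

/-- Every state can be reached from every state through transitions of positive rate. -/
def IsIrreducibleRateMatrix {E : Type*} (Q : Matrix E E ℝ) : Prop :=
  ∀ x y, Relation.ReflTransGen (fun u v => u ≠ v ∧ 0 < Q u v) x y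

/-- `J` is a continuous-time Markov chain with transition rate matrix `Q`, that is, with
transition matrices `exp (s Q)`, and with arbitrary initial distribution. The Markov property
`P(J(t₀) = x₀, …, J(tₘ₊₁) = xₘ₊₁) = P(J(t₀) = x₀, …, J(tₘ) = xₘ) · exp((tₘ₊₁ - tₘ) Q)(xₘ, xₘ₊₁)` is
stated for all times `t₀ ≤ t₁ ≤ …` and all states. -/
def IsMarkovChainWithRates {Ω E : Type*} [MeasurableSpace Ω] [Fintype E] [DecidableEq E]
    (P : Measure Ω) (J : ℝ≥0 → Ω → E) (Q : Matrix E E ℝ) : Prop :=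
  ∀ (m : ℕ) (s : ℕ → ℝ≥0) (x : ℕ → E), Monotone s →
    P.real {ω | ∀ i ≤ m + 1, J (s i) ω = x i} =
      P.real {ω | ∀ i ≤ m, J (s i) ω = x i} *
        NormedSpace.exp (((s (m + 1) : ℝ) - (s m : ℝ)) • Q) (x m) (x (m + 1))

/-- `J` is an irreducible continuous-time Markov chain on the finite set `E`. -/
def IsIrreducibleMarkovChain {Ω E : Type*} [MeasurableSpace Ω] [Fintype E] [DecidableEq E]
    (P : Measure Ω) (J : ℝ≥0 → Ω → E) : Prop :=
  ∃ Q : Matrix E E ℝ, IsRateMatrix Q ∧ IsIrreducibleRateMatrix Q ∧ IsMarkovChainWithRates P J Q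

/-! ### The modulated infinite-server queue

`lam`, `kap`, `mu` are the functions modulating the arrival rate, the service requirements and the
server work rate; `f` is a path of the background process, `e` the sequence of interarrival times of
the standard Poisson process and `z` the sequence of standard exponential requirements. Jobs are
numbered from `0`. -/

section Queue

variable {E : Type*}

/-- The cumulative arrival rate `Λ(t) = ∫₀ᵗ λ(f(s)) ds`. -/
def cumRate (lam : E → ℝ≥0) (f : ℝ≥0 → E) (t : ℝ≥0) : ℝ :=
  ∫ s in (0 : ℝ)..t, (lam (f s.toNNReal) : ℝ)

/-- The `k`-th jump time of the standard Poisson process with interarrival times `e`. -/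
def poissonJumpTime (e : ℕ → ℝ) (k : ℕ) : ℝ := ∑ i ∈ Finset.range (k + 1), e i

/-- The arrival time `τₖ = inf {t ≥ 0 | Λ(t) ≥ τ̄ₖ}` of job `k`, where `τ̄ₖ` is the `k`-th jump time of
the standard Poisson process; it is `∞` if there is no such `t`. -/
def arrivalTime (lam : E → ℝ≥0) (f : ℝ≥0 → E) (e : ℕ → ℝ) (k : ℕ) : ℝ≥0∞ :=
  ⨅ (t : ℝ≥0) (_ : poissonJumpTime e k ≤ cumRate lam f t), (t : ℝ≥0∞)

/-- The service requirement of a job that arrives while the background process is in state `x`: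
the standard exponential `z` divided by `κ(x)`, and `∞` if `κ(x) = 0`. -/
def serviceRequirement (kap : E → ℝ≥0) (x : E) (z : ℝ) : ℝ≥0∞ :=
  open Classical in if kap x = 0 then ⊤ else ENNReal.ofReal (z / kap x)

/-- The work done up to time `t` by a server that starts at time `u`. -/
def workDone (mu : E → ℝ≥0) (f : ℝ≥0 → E) (u t : ℝ≥0) : ℝ≥0∞ :=
  ENNReal.ofReal (∫ r in (u : ℝ)..t, (mu (f r.toNNReal) : ℝ))

/-- Job `k` is in the system at time `t`: it has arrived, and its service requirement has not been
processed yet. -/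
def InSystem (lam kap mu : E → ℝ≥0) (f : ℝ≥0 → E) (e z : ℕ → ℝ) (t : ℝ≥0) (k : ℕ) : Prop :=
  arrivalTime lam f e k ≤ t ∧
    ¬ serviceRequirement kap (f (arrivalTime lam f e k).toNNReal) (z k)
        ≤ workDone mu f (arrivalTime lam f e k).toNNReal t

/-- The number `M(t)` of jobs in the system at time `t` (almost surely finite). -/
def numJobs (lam kap mu : E → ℝ≥0) (f : ℝ≥0 → E) (e z : ℕ → ℝ) (t : ℝ≥0) : ℝ≥0∞ :=
  open Classical in ∑' k : ℕ, if InSystem lam kap mu f e z t k then 1 else 0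

/-- The parameter
`φₜ(f) = ∫₀ᵗ λ(f(s)) exp (-κ(f(s)) ∫ₛᵗ μ(f(r)) dr) ds`. -/
def phi (lam kap mu : E → ℝ≥0) (t : ℝ≥0) (f : ℝ≥0 → E) : ℝ :=
  ∫ s in (0 : ℝ)..t, (lam (f s.toNNReal) : ℝ) *
    Real.exp (-((kap (f s.toNNReal) : ℝ) * ∫ r in s..(t : ℝ), (mu (f r.toNNReal) : ℝ)))

variable {Ω : Type*} [MeasurableSpace Ω]

/-- The random objects that drive a modulated infinite-server queue: a background process `J`, a
standard Poisson process with interarrival times `e`, and standard exponential random variables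
`z k`, all of them independent. -/
structure IsQueueInput [TopologicalSpace E] [MeasurableSpace E] (P : Measure Ω)
    (J : ℝ≥0 → Ω → E) (e z : ℕ → Ω → ℝ) : Prop where
  background : IsBackgroundProcess J
  measurable_e : ∀ k, Measurable (e k)
  measurable_z : ∀ k, Measurable (z k)
  map_e : ∀ k, P.map (e k) = expMeasure 1
  map_z : ∀ k, P.map (z k) = expMeasure 1
  iIndep : iIndepFun (Sum.elim e z) P
  indep : IndepFun (fun ω (s : ℝ≥0) => J s ω) (fun ω (i : ℕ ⊕ ℕ) => Sum.elim e z i ω) P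

/-- The law of `Mₙ(t) / n`, where `Mₙ(t)` is the number of jobs at time `t` in the queue
`(J, n λ, κ, μ)`. -/
def scaledLaw (P : Measure Ω) (J : ℝ≥0 → Ω → E) (e z : ℕ → Ω → ℝ) (lam kap mu : E → ℝ≥0)
    (t : ℝ≥0) (n : ℕ) : Measure ℝ :=
  P.map fun ω =>
    (numJobs (fun x => (n : ℝ≥0) * lam x) kap mu (fun s => J s ω) (fun k => e k ω)
      (fun k => z k ω) t).toReal / n

/-- The law of the random parameter `φₜ(J)`. -/
def paramLaw (P : Measure Ω) (J : ℝ≥0 → Ω → E) (lam kap mu : E → ℝ≥0) (t : ℝ≥0) : Measure ℝ :=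
  P.map fun ω => phi lam kap mu t (fun s => J s ω)

end Queue

/-! ### The rate function of the number of jobs -/

/-- The Fenchel-Legendre transform `ℓ(γ; a) = sup_θ (θ a - log E exp (θ X))` of the cumulant
generating function of a Poisson variable `X` with parameter `γ`. (The supremum is nonnegative, as
`θ = 0` contributes `0`.) -/
def ell (γ : ℝ≥0) (a : ℝ) : ℝ≥0∞ :=
  ⨆ θ : ℝ, ENNReal.ofReal (θ * a - cgf (fun k : ℕ => (k : ℝ)) (poissonMeasure γ) θ)

/-- The attainable parameters of the sequence `ν n` of laws of the random parameters. -/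
def attainable (ν : ℕ → Measure ℝ) : Set ℝ≥0 :=
  {γ | ∀ ε : ℝ, 0 < ε → ∃ N : ℕ, ∀ n ≥ N, 0 < ν n (Metric.ball (γ : ℝ) ε)}

/-- The function `I(a) = inf_{γ ∈ R(t)} [ℓ(γ; a) + ψ(γ)]`. -/
def rateI (ν : ℕ → Measure ℝ) (ψ : ℝ → ℝ≥0∞) (a : ℝ) : ℝ≥0∞ :=
  ⨅ γ ∈ attainable ν, (ell γ a + ψ (γ : ℝ))

end ModulatedQueue

end

namespace ModulatedQueue

/-! ### Tools for the large deviations principle -/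

/-! The laws `ν n` do not depend on `n`. Hence the attainable parameters are exactly the support of
the single law `ν` of `φₜ(J)`, an LDP for the constant sequence always holds (rate `0` on the
support, `∞` off it), and every rate function of that sequence vanishes on the support. So `ψ` drops
out and `I(a) = inf {ℓ(γ; a) | γ ∈ supp ν}` (`rateI_const`).

Given `J`, the number of jobs in the queue `(J, nλ, κ, μ)` is Poisson with parameter `n φₜ(J)`: the
jobs in the system are the retained points of a marked Poisson process. To prove this, points in a
set `R` get weight `exp θ`, the weights of the first `K` points are multiplied, and the product is
compensated by the expected effect of the later points. The result has constant expectation in `K`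
(`IsMarkedPoisson.lintegral_compensated`), and its limit is the Poisson moment generating function.
A change of variables along the cumulative arrival rate identifies the parameter as `φₜ`
(`integral_retention_systemSet`). By independence, the law of `Mₙ(t)/n` is therefore a mixture of
scaled Poisson laws over `ν` (`IsQueueInput.scaledLaw_apply`).

For such a mixture the upper bound is a Chernoff estimate that is uniform over the support
(`mixture_closed_le`). For the lower bound the mixture is restricted to a small ball around a point
of the support, whose mass is positive and independent of `n`, and to a single atom estimated by
Stirling's formula (`mixture_open_ge`). As `φₜ` is bounded, the support is compact, which makes `I`
a good rate function.

For the comparison, an irreducible chain stays, with positive probability, close to any càdlàg path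
in the sense that the total time up to `t` spent in a different state is small
(`IsIrreducibleMarkovChain.measure_mismatch_pos`), and `φₜ` is Lipschitz in that time
(`abs_phi_sub_phi_le`). So every parameter attainable for `J⁽¹⁾` is attainable for `J⁽²⁾`, and the
infimum defining `I⁽²⁾` runs over a larger set. -/

lemma mul_log_ofReal_exp (n : ℕ) (x : ℝ) :
    ((1 / (n : ℝ) : ℝ) : EReal) * ENNReal.log (ENNReal.ofReal (Real.exp x))
      = ((x / n : ℝ) : EReal) := by
  rw [ENNReal.log_ofReal_of_pos (Real.exp_pos x), Real.log_exp, ← EReal.coe_mul]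
  congr 1
  ring

lemma mul_log_mono (n : ℕ) {u v : ℝ≥0∞} (h : u ≤ v) :
    ((1 / (n : ℝ) : ℝ) : EReal) * ENNReal.log u ≤ ((1 / (n : ℝ) : ℝ) : EReal) * ENNReal.log v :=
  mul_le_mul_of_nonneg_left (ENNReal.log_monotone h) (by positivity)

/-- The exponent is an arbitrary real sequence, so that factors without exponential effect, such as
`2` or a fixed `ν(A)`, are absorbed in a real limit and no `EReal` arithmetic remains. -/
lemma limsup_log_le_of_eventually_le_exp {u : ℕ → ℝ≥0∞} {x : ℕ → ℝ} {L : ℝ}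
    (h : ∀ᶠ n in atTop, u n ≤ ENNReal.ofReal (Real.exp (x n)))
    (hx : Tendsto (fun n => x n / n) atTop (𝓝 L)) :
    limsup (fun n : ℕ => ((1 / (n : ℝ) : ℝ) : EReal) * ENNReal.log (u n)) atTop ≤ (L : EReal) := by
  have h1 : Tendsto (fun n => ((x n / n : ℝ) : EReal)) atTop (𝓝 (L : EReal)) :=
    (continuous_coe_real_ereal.tendsto L).comp hx
  rw [← h1.limsup_eq]
  refine limsup_le_limsup ?_
  filter_upwards [h] with n hn
  exact (mul_log_mono n hn).trans_eq (mul_log_ofReal_exp n _)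

lemma le_liminf_log_of_eventually_exp_le {u : ℕ → ℝ≥0∞} {x : ℕ → ℝ} {L : ℝ}
    (h : ∀ᶠ n in atTop, ENNReal.ofReal (Real.exp (x n)) ≤ u n)
    (hx : Tendsto (fun n => x n / n) atTop (𝓝 L)) :
    (L : EReal) ≤ liminf (fun n : ℕ => ((1 / (n : ℝ) : ℝ) : EReal) * ENNReal.log (u n)) atTop := by
  have h1 : Tendsto (fun n => ((x n / n : ℝ) : EReal)) atTop (𝓝 (L : EReal)) :=
    (continuous_coe_real_ereal.tendsto L).comp hx
  rw [← h1.liminf_eq]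
  refine liminf_le_liminf ?_
  filter_upwards [h] with n hn
  exact (mul_log_ofReal_exp n _).symm.trans_le (mul_log_mono n hn)

lemma limsup_log_le_zero {u : ℕ → ℝ≥0∞} (h : ∀ n, u n ≤ 1) :
    limsup (fun n : ℕ => ((1 / (n : ℝ) : ℝ) : EReal) * ENNReal.log (u n)) atTop ≤ 0 := by
  have := limsup_log_le_of_eventually_le_exp (u := u) (x := fun _ => 0) (L := 0)
    (Eventually.of_forall fun n => by simpa using h n) (by simp)
  simpa using this

/-- A limsup is at most `-c` as soon as it is at most `-r` for all real `r < c`. -/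
lemma EReal_le_neg_of_forall_lt {y : EReal} {c : ℝ≥0∞} (h0 : y ≤ 0)
    (h : ∀ r : ℝ≥0, (r : ℝ≥0∞) < c → y ≤ ((-(r : ℝ) : ℝ) : EReal)) : y ≤ -(c : EReal) := by
  rw [EReal.le_neg]
  refine le_of_forall_lt fun b hb => ?_
  by_contra hcon
  push Not at hcon
  -- The assumption `h0` serves only negative `b`, where no nonnegative `r` is available.
  rcases lt_or_ge b 0 with hb0 | hb0
  · have : (0 : EReal) ≤ -y := by rw [EReal.le_neg]; simpa using h0
    exact absurd (hcon.trans_lt hb0) (not_lt.2 this)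
  · obtain ⟨d, hd1, hd2⟩ := EReal.lt_iff_exists_real_btwn.1 hb
    have hd0 : 0 ≤ d := by
      have : (0 : EReal) ≤ (d : EReal) := hb0.trans hd1.le
      exact_mod_cast this
    lift d to ℝ≥0 using hd0
    have h3 : (d : ℝ≥0∞) < c := by
      rw [← EReal.coe_ennreal_lt_coe_ennreal_iff]
      exact hd2
    have h4 := h _ h3
    have h5 : ((d : ℝ) : EReal) ≤ -y := by
      rw [EReal.le_neg]; simpa using h4
    exact absurd (h5.trans hcon) (not_le.2 hd1)

/-- `-c` is at most a liminf as soon as `-r` is for all real `r > c`. -/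
lemma EReal_neg_le_of_forall_gt {y : EReal} {c : ℝ≥0∞}
    (h : ∀ r : ℝ≥0, c < (r : ℝ≥0∞) → ((-(r : ℝ) : ℝ) : EReal) ≤ y) : -(c : EReal) ≤ y := by
  rw [EReal.neg_le]
  refine le_of_forall_gt fun b hb => ?_
  obtain ⟨d, hd1, hd2⟩ := EReal.lt_iff_exists_real_btwn.1 hb
  have hd0 : 0 ≤ d := by
    have : (0 : EReal) ≤ (d : EReal) := (EReal.coe_ennreal_nonneg c).trans hd1.le
    exact_mod_cast this
  lift d to ℝ≥0 using hd0
  have h3 : c < (d : ℝ≥0∞) := by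
    rw [← EReal.coe_ennreal_lt_coe_ennreal_iff]
    exact hd1
  have h4 := h _ h3
  refine lt_of_le_of_lt ?_ hd2
  rw [EReal.neg_le]
  simpa using h4

/-! ### Constant sequences -/

lemma mem_attainable_const {ν : Measure ℝ} {γ : ℝ≥0} :
    γ ∈ attainable (fun _ => ν) ↔ (γ : ℝ) ∈ ν.support := by
  rw [Metric.nhds_basis_ball.mem_measureSupport]
  simp only [attainable, Set.mem_ofPred_eq]
  exact ⟨fun h ε hε => let ⟨N, hN⟩ := h ε hε; hN N le_rfl, fun h ε hε => ⟨0, fun _ _ => h ε hε⟩⟩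

lemma ofReal_exp_log_real {X : Type*} [MeasurableSpace X] {ν : Measure X} [IsFiniteMeasure ν]
    {s : Set X} (h : 0 < ν s) : ENNReal.ofReal (Real.exp (Real.log (ν.real s))) = ν s := by
  have h1 : 0 < ν.real s := ENNReal.toReal_pos h.ne' (measure_ne_top _ _)
  rw [Real.exp_log h1, Measure.real, ENNReal.ofReal_toReal (measure_ne_top _ _)]

/-- A fixed positive probability disappears under `n⁻¹ log`, and a set that misses the support is
null. Open sets that meet the support have positive mass. -/
lemma satisfiesLDP_const (ν : Measure ℝ) [IsProbabilityMeasure ν] :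
    SatisfiesLDP (fun _ => ν) (fun x => open Classical in if x ∈ ν.support then 0 else ⊤) where
  isRateFunction := by
    intro x y hy
    by_cases hx : x ∈ ν.support
    · simp [hx] at hy
    · have : ν.supportᶜ ∈ 𝓝 x := Measure.isOpen_compl_support.mem_nhds hx
      filter_upwards [this] with z hz
      simp only [hx, if_false] at hy
      have hz' : z ∉ ν.support := hz
      simpa [hz'] using hy
  upper F _ := by
    by_cases hF : (F ∩ ν.support).Nonempty
    · obtain ⟨x, hx, hxs⟩ := hF
      have : (⨅ a ∈ F, (open Classical in if a ∈ ν.support then 0 else ⊤ : ℝ≥0∞)) = 0 :=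
        le_antisymm (iInf₂_le_of_le x hx (by simp [hxs])) bot_le
      rw [this]
      simpa using limsup_log_le_zero (u := fun _ => ν F) fun _ => prob_le_one
    · have h0 : ν F = 0 := by
        refine measure_mono_null (t := ν.supportᶜ) (fun x hx hs => hF ⟨x, hx, hs⟩)
          Measure.measure_compl_support
      refine EReal_le_neg_of_forall_lt
        (limsup_log_le_zero (u := fun _ => ν F) fun _ => prob_le_one) fun r _ => ?_
      refine limsup_log_le_of_eventually_le_exp (u := fun _ => ν F) (x := fun n => n * (-(r : ℝ)))
        (Eventually.of_forall fun n => by simp [h0]) ?_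
      refine tendsto_const_nhds.congr' ?_
      filter_upwards [eventually_ne_atTop 0] with n hn
      field_simp
  lower G hG := by
    by_cases hGs : (G ∩ ν.support).Nonempty
    · obtain ⟨x, hx, hxs⟩ := hGs
      have hpos : 0 < ν G := (Measure.mem_support_iff_forall x).1 hxs G (hG.mem_nhds hx)
      have : (⨅ a ∈ G, (open Classical in if a ∈ ν.support then 0 else ⊤ : ℝ≥0∞)) = 0 :=
        le_antisymm (iInf₂_le_of_le x hx (by simp [hxs])) bot_le
      rw [this]
      have := le_liminf_log_of_eventually_exp_le (u := fun _ => ν G) (L := 0)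
        (x := fun n => Real.log (ν.real G)) (Eventually.of_forall fun _ => (ofReal_exp_log_real hpos).le) (tendsto_const_div_atTop_nhds_zero_nat _)
      simpa using this
    · have : (⨅ a ∈ G, (open Classical in if a ∈ ν.support then 0 else ⊤ : ℝ≥0∞)) = ⊤ := by
        refine iInf₂_eq_top.2 fun a ha => ?_
        rw [if_neg fun hs => hGs ⟨a, ha, hs⟩]
      rw [this]
      simp

/-- The rate function of a constant sequence vanishes on the support. -/
lemma SatisfiesLDP.eq_zero_of_mem_support {ν : Measure ℝ} [IsProbabilityMeasure ν] {ψ : ℝ → ℝ≥0∞}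
    (h : SatisfiesLDP (fun _ => ν) ψ) {x : ℝ} (hx : x ∈ ν.support) : ψ x = 0 := by
  by_contra hne
  -- By lower semicontinuity `ψ > c > 0` on a closed ball around `x`. The upper bound would then
  -- force exponential decay of its mass, which is a positive constant.
  obtain ⟨c, hc0, hc⟩ := exists_between (pos_iff_ne_zero.2 hne)
  obtain ⟨ε, hε, hball⟩ := Metric.nhds_basis_closedBall.mem_iff.1 (h.isRateFunction x c hc)
  have hpos : 0 < ν (Metric.closedBall x ε) :=
    (Measure.mem_support_iff_forall x).1 hx _ (Metric.closedBall_mem_nhds x hε)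
  have h1 := le_liminf_log_of_eventually_exp_le (u := fun _ => ν (Metric.closedBall x ε)) (L := 0)
    (x := fun n => Real.log (ν.real (Metric.closedBall x ε))) (Eventually.of_forall fun _ => (ofReal_exp_log_real hpos).le) (tendsto_const_div_atTop_nhds_zero_nat _)
  have h2 := (h1.trans (liminf_le_limsup)).trans (h.upper _ Metric.isClosed_closedBall)
  have h3 : c ≤ ⨅ a ∈ Metric.closedBall x ε, ψ a := le_iInf₂ fun a ha => (hball ha).le
  rw [EReal.le_neg] at h2
  have h4 : ((⨅ a ∈ Metric.closedBall x ε, ψ a : ℝ≥0∞) : EReal) ≤ ((0 : ℝ≥0∞) : EReal) := by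
    simpa using h2
  rw [EReal.coe_ennreal_le_coe_ennreal_iff] at h4
  exact absurd (h3.trans h4) (not_le.2 hc0)

/-- Only the values of `ψ` on the support enter, so uniqueness of rate functions is not needed. -/
lemma rateI_const {ν : Measure ℝ} [IsProbabilityMeasure ν] {ψ : ℝ → ℝ≥0∞}
    (h : SatisfiesLDP (fun _ => ν) ψ) (a : ℝ) :
    rateI (fun _ => ν) ψ a = ⨅ γ ∈ attainable (fun _ => ν), ell γ a := by
  refine iInf_congr fun γ => iInf_congr fun hγ => ?_
  rw [h.eq_zero_of_mem_support (mem_attainable_const.1 hγ), add_zero]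

/-! ### The Poisson distribution -/

lemma hasSum_poisson_exp (r : ℝ≥0) (θ : ℝ) :
    HasSum (fun k : ℕ => Real.exp (-r) * (r : ℝ) ^ k / (k.factorial : ℝ) * Real.exp (θ * k))
      (Real.exp (r * (Real.exp θ - 1))) := by
  have h := (NormedSpace.expSeries_div_hasSum_exp (𝔸 := ℝ) ((r : ℝ) * Real.exp θ)).mul_left
    (Real.exp (-r))
  rw [← Real.exp_eq_exp_ℝ, ← Real.exp_add] at h
  have e : (r : ℝ) * (Real.exp θ - 1) = -r + r * Real.exp θ := by ring
  rw [e]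
  refine h.congr_fun fun k => ?_
  rw [mul_pow, ← Real.exp_nat_mul, mul_comm θ]
  ring

lemma integrable_exp_poisson (r : ℝ≥0) (θ : ℝ) :
    Integrable (fun k : ℕ => Real.exp (θ * k)) (poissonMeasure r) := by
  rw [integrable_poissonMeasure_iff]
  refine (hasSum_poisson_exp r θ).summable.congr fun k => ?_
  simp [mul_comm]

lemma mgf_poisson (r : ℝ≥0) (θ : ℝ) :
    mgf (fun k : ℕ => (k : ℝ)) (poissonMeasure r) θ = Real.exp (r * (Real.exp θ - 1)) := by
  rw [mgf, integral_poissonMeasure, ← (hasSum_poisson_exp r θ).tsum_eq]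
  simp

lemma cgf_poisson (r : ℝ≥0) (θ : ℝ) :
    cgf (fun k : ℕ => (k : ℝ)) (poissonMeasure r) θ = r * (Real.exp θ - 1) := by
  rw [cgf, mgf_poisson, Real.log_exp]

lemma ell_eq (γ : ℝ≥0) (a : ℝ) :
    ell γ a = ⨆ θ : ℝ, ENNReal.ofReal (θ * a - γ * (Real.exp θ - 1)) := by
  simp only [ell, cgf_poisson]

lemma le_ell (γ : ℝ≥0) (a θ : ℝ) :
    ENNReal.ofReal (θ * a - γ * (Real.exp θ - 1)) ≤ ell γ a := by
  rw [ell_eq]; exact le_iSup (fun θ : ℝ => ENNReal.ofReal (θ * a - γ * (Real.exp θ - 1))) θ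

lemma exists_lt_of_lt_ell {γ c : ℝ≥0} {a : ℝ} (h : (c : ℝ≥0∞) < ell γ a) :
    ∃ θ : ℝ, (c : ℝ) < θ * a - γ * (Real.exp θ - 1) := by
  rw [ell_eq, lt_iSup_iff] at h
  obtain ⟨θ, hθ⟩ := h
  refine ⟨θ, ?_⟩
  rw [← ENNReal.ofReal_coe_nnreal] at hθ
  exact (ENNReal.ofReal_lt_ofReal_iff_of_nonneg c.2).1 hθ

lemma le_of_ell_lt {γ c : ℝ≥0} {a : ℝ} (h : ell γ a ≤ (c : ℝ≥0∞)) (θ : ℝ) :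
    θ * a - γ * (Real.exp θ - 1) ≤ c := by
  have := (le_ell γ a θ).trans h
  rw [← ENNReal.ofReal_coe_nnreal] at this
  exact (ENNReal.ofReal_le_ofReal_iff c.2).1 this

lemma lowerSemicontinuous_ell : LowerSemicontinuous (fun p : ℝ≥0 × ℝ => ell p.1 p.2) := by
  simp_rw [ell_eq]
  refine lowerSemicontinuous_iSup fun θ => Continuous.lowerSemicontinuous ?_
  exact ENNReal.continuous_ofReal.comp (by fun_prop)

/-! ### The rate function -/

section RateFunction

variable {R : Set ℝ≥0}

/-- An infimum of lower semicontinuous functions need not be lower semicontinuous. Here `ℓ` is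
jointly so and `R` is compact, and the tube lemma makes a lower bound at `a` persist nearby for all
`γ ∈ R` at once. -/
lemma lowerSemicontinuous_iInf_ell (hR : IsCompact R) :
    LowerSemicontinuous (fun a => ⨅ γ ∈ R, ell γ a) := by
  intro a c hc
  obtain ⟨d, hcd, hd⟩ := exists_between hc
  have hopen : IsOpen {p : ℝ≥0 × ℝ | d < ell p.1 p.2} :=
    lowerSemicontinuous_ell.isOpen_preimage d
  have hsub : R ×ˢ {a} ⊆ {p : ℝ≥0 × ℝ | d < ell p.1 p.2} := by
    rintro ⟨γ, b⟩ ⟨hγ, hb⟩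
    have hb : b = a := hb
    subst hb
    exact hd.trans_le (iInf₂_le γ hγ)
  obtain ⟨U, V, hU, hV, hRU, haV, hUV⟩ := generalized_tube_lemma hR isCompact_singleton hopen hsub
  filter_upwards [hV.mem_nhds (haV rfl)] with b hb
  exact hcd.trans_le (le_iInf₂ fun γ hγ => (hUV (Set.mk_mem_prod (hRU hγ) hb)).le)

/-- The values `θ = 1` and `θ = -1` in the Legendre transform bound `a` from above and below on a
level set, the upper bound using that `R` is bounded. -/
lemma isGoodRateFunction_iInf_ell (hR : IsCompact R) :
    IsGoodRateFunction (fun a => ⨅ γ ∈ R, ell γ a) := by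
  refine ⟨lowerSemicontinuous_iInf_ell hR, fun c => ?_⟩
  obtain ⟨C, hC⟩ := hR.bddAbove
  have hclosed : IsClosed {x | (⨅ γ ∈ R, ell γ x) ≤ c} :=
    (lowerSemicontinuous_iInf_ell hR).isClosed_preimage c
  refine (isCompact_Icc (a := -((c : ℝ) + 1)) (b := c + 1 + C * (Real.exp 1 - 1))).of_isClosed_subset
    hclosed fun a ha => ?_
  -- The slack `1` gives a strict inequality, hence an actual `γ` without knowing that the infimum
  -- is attained.
  have hlt : (⨅ γ ∈ R, ell γ a) < ((c + 1 : ℝ≥0) : ℝ≥0∞) :=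
    lt_of_le_of_lt ha (by exact_mod_cast lt_add_one c)
  simp only [iInf_lt_iff] at hlt
  obtain ⟨γ, hγ, h⟩ := hlt
  have h1 := le_of_ell_lt h.le 1
  have h2 := le_of_ell_lt h.le (-1)
  have hγC : (γ : ℝ) ≤ C := by exact_mod_cast hC hγ
  have he : (1 : ℝ) ≤ Real.exp 1 := Real.one_le_exp zero_le_one
  have he' : Real.exp (-1) ≤ 1 := Real.exp_le_one_iff.2 (by norm_num)
  have h3 : (γ : ℝ) * (Real.exp 1 - 1) ≤ C * (Real.exp 1 - 1) :=
    mul_le_mul_of_nonneg_right hγC (by linarith)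
  have h4 : (γ : ℝ) * (Real.exp (-1) - 1) ≤ 0 :=
    mul_nonpos_of_nonneg_of_nonpos γ.2 (by linarith)
  push_cast at h1 h2
  constructor <;> linarith

end RateFunction

/-! ### Mixtures of scaled Poisson distributions -/

/-- For `θ ≥ 0` this is Chernoff's bound. For `θ ≤ 0` the bound is at least `1`, because `b ≥ γ` and
`exp θ - 1 ≥ θ`. Allowing every `θ` avoids having to find the sign of the one that witnesses `ℓ(γ;
b) > c`. -/
lemma poisson_real_ge_le (γ : ℝ≥0) {n : ℕ} (hn : n ≠ 0) {b : ℝ} (hb : (γ : ℝ) ≤ b) (θ : ℝ) :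
    (poissonMeasure (n * γ)).real {k : ℕ | b ≤ (k : ℝ) / n}
      ≤ Real.exp (-(n * (θ * b - γ * (Real.exp θ - 1)))) := by
  have hn' : (0 : ℝ) < n := by positivity
  rcases le_total 0 θ with hθ | hθ
  · have := measure_ge_le_exp_mul_mgf (μ := poissonMeasure (n * γ)) (X := fun k : ℕ => (k : ℝ))
      (n * b) hθ (integrable_exp_poisson _ _)
    rw [mgf_poisson, ← Real.exp_add] at this
    refine le_trans (le_of_eq ?_) (this.trans (le_of_eq ?_))
    · congr 1; ext k
      simp only [Set.mem_ofPred_eq]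
      rw [le_div_iff₀ hn', mul_comm]
    · push_cast; congr 1; ring
  · refine measureReal_le_one.trans ?_
    refine Real.one_le_exp ?_
    have h1 : θ * b ≤ θ * γ := mul_le_mul_of_nonpos_left hb hθ
    have h2 : (γ : ℝ) * θ ≤ γ * (Real.exp θ - 1) :=
      mul_le_mul_of_nonneg_left (by linarith [Real.add_one_le_exp θ]) γ.2
    have : θ * b - γ * (Real.exp θ - 1) ≤ 0 := by linarith
    nlinarith

lemma poisson_real_le_le (γ : ℝ≥0) {n : ℕ} (hn : n ≠ 0) {b : ℝ} (hb : b ≤ (γ : ℝ)) (θ : ℝ) :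
    (poissonMeasure (n * γ)).real {k : ℕ | (k : ℝ) / n ≤ b}
      ≤ Real.exp (-(n * (θ * b - γ * (Real.exp θ - 1)))) := by
  have hn' : (0 : ℝ) < n := by positivity
  rcases le_total θ 0 with hθ | hθ
  · have := measure_le_le_exp_mul_mgf (μ := poissonMeasure (n * γ)) (X := fun k : ℕ => (k : ℝ))
      (n * b) hθ (integrable_exp_poisson _ _)
    rw [mgf_poisson, ← Real.exp_add] at this
    refine le_trans (le_of_eq ?_) (this.trans (le_of_eq ?_))
    · congr 1; ext k
      simp only [Set.mem_ofPred_eq]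
      rw [div_le_iff₀ hn', mul_comm]
    · push_cast; congr 1; ring
  · refine measureReal_le_one.trans ?_
    refine Real.one_le_exp ?_
    have h1 : θ * b ≤ θ * γ := mul_le_mul_of_nonneg_left hb hθ
    have h2 : (γ : ℝ) * θ ≤ γ * (Real.exp θ - 1) :=
      mul_le_mul_of_nonneg_left (by linarith [Real.add_one_le_exp θ]) γ.2
    have : θ * b - γ * (Real.exp θ - 1) ≤ 0 := by linarith
    nlinarith

/-- On either side of the mean `γ`, the set `F` lies in the half-line that starts at its point
nearest to `γ`, and that point is in `F` because `F` is closed. The two sides give the factor `2`;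
the bound does not depend on `γ` otherwise, so it can be integrated over a mixture. -/
lemma poisson_closed_le (γ : ℝ≥0) {n : ℕ} (hn : n ≠ 0) {F : Set ℝ} (hF : IsClosed F) {c : ℝ≥0}
    (hc : ∀ b ∈ F, (c : ℝ≥0∞) < ell γ b) :
    (poissonMeasure (n * γ)).real {k : ℕ | (k : ℝ) / n ∈ F} ≤ 2 * Real.exp (-(n * c)) := by
  have key : ∀ b ∈ F, ∃ θ : ℝ, Real.exp (-(n * (θ * b - γ * (Real.exp θ - 1))))
      ≤ Real.exp (-(n * c)) := by
    intro b hb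
    obtain ⟨θ, hθ⟩ := exists_lt_of_lt_ell (hc b hb)
    refine ⟨θ, Real.exp_le_exp.2 (neg_le_neg (mul_le_mul_of_nonneg_left hθ.le (by positivity)))⟩
  have h1 : (poissonMeasure (n * γ)).real {k : ℕ | (k : ℝ) / n ∈ F ∩ Set.Ici (γ : ℝ)}
      ≤ Real.exp (-(n * c)) := by
    rcases (F ∩ Set.Ici (γ : ℝ)).eq_empty_or_nonempty with h | h
    · rw [h]; simp [Real.exp_nonneg]
    · have hbdd : BddBelow (F ∩ Set.Ici (γ : ℝ)) := ⟨γ, fun x hx => hx.2⟩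
      have hmem := (hF.inter isClosed_Ici).csInf_mem h hbdd
      obtain ⟨θ, hθ⟩ := key _ hmem.1
      refine (measureReal_mono fun k hk => ?_).trans ((poisson_real_ge_le γ hn hmem.2 θ).trans hθ)
      exact csInf_le hbdd hk
  have h2 : (poissonMeasure (n * γ)).real {k : ℕ | (k : ℝ) / n ∈ F ∩ Set.Iic (γ : ℝ)}
      ≤ Real.exp (-(n * c)) := by
    rcases (F ∩ Set.Iic (γ : ℝ)).eq_empty_or_nonempty with h | h
    · rw [h]; simp [Real.exp_nonneg]
    · have hbdd : BddAbove (F ∩ Set.Iic (γ : ℝ)) := ⟨γ, fun x hx => hx.2⟩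
      have hmem := (hF.inter isClosed_Iic).csSup_mem h hbdd
      obtain ⟨θ, hθ⟩ := key _ hmem.1
      refine (measureReal_mono fun k hk => ?_).trans ((poisson_real_le_le γ hn hmem.2 θ).trans hθ)
      exact le_csSup hbdd hk
  have h3 : {k : ℕ | (k : ℝ) / n ∈ F} ⊆ {k : ℕ | (k : ℝ) / n ∈ F ∩ Set.Ici (γ : ℝ)} ∪
      {k : ℕ | (k : ℝ) / n ∈ F ∩ Set.Iic (γ : ℝ)} := by
    intro k hk
    rcases le_total (γ : ℝ) ((k : ℝ) / n) with h | h
    · exact Or.inl ⟨hk, h⟩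
    · exact Or.inr ⟨hk, h⟩
  have h4 := (measureReal_mono (μ := poissonMeasure (n * γ)) h3).trans (measureReal_union_le _ _)
  linarith

/-- `n⁻¹ log (n ^ k / k!) → a - a log a` when `k / n → a > 0`. -/
lemma tendsto_log_factorial {a : ℝ} (ha : 0 < a) :
    Tendsto (fun n : ℕ => (⌊a * n⌋₊ * Real.log n - Real.log (⌊a * n⌋₊.factorial : ℝ)) / n) atTop
      (𝓝 (a - a * Real.log a)) := by
  have hk : Tendsto (fun n : ℕ => (⌊a * n⌋₊ : ℝ) / n) atTop (𝓝 a) :=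
    (tendsto_nat_floor_mul_div_atTop ha.le).comp tendsto_natCast_atTop_atTop
  have hk' : Tendsto (fun n : ℕ => ⌊a * n⌋₊) atTop atTop :=
    tendsto_nat_floor_atTop.comp (tendsto_natCast_atTop_atTop.const_mul_atTop ha)
  have hinv : Tendsto (fun n : ℕ => (1 : ℝ) / n) atTop (𝓝 0) :=
    tendsto_const_div_atTop_nhds_zero_nat 1
  have hst : Tendsto (fun n : ℕ => Real.log (Stirling.stirlingSeq ⌊a * n⌋₊)) atTop
      (𝓝 (Real.log (√Real.pi))) :=
    ((Real.continuousAt_log (Real.sqrt_ne_zero'.2 Real.pi_pos)).tendsto.comp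
      Stirling.tendsto_stirlingSeq_sqrt_pi).comp hk'
  have hkr : Tendsto (fun n : ℕ => (⌊a * n⌋₊ : ℝ)) atTop atTop :=
    tendsto_natCast_atTop_atTop.comp hk'
  have hlog : Tendsto (fun n : ℕ => Real.log (2 * ⌊a * n⌋₊) / (2 * ⌊a * n⌋₊)) atTop (𝓝 0) :=
    (Real.isLittleO_log_id_atTop.tendsto_div_nhds_zero).comp (hkr.const_mul_atTop two_pos)
  -- With `k = ⌊a n⌋`, Stirling's formula reads `log k! = k log k - k + log (2 k) / 2 + log
  -- (stirlingSeq k)`. After division by `n` the last two terms vanish in the limit.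
  have hmain := ((hk.sub (hk.mul ((Real.continuousAt_log ha.ne').tendsto.comp hk))).sub
    (hlog.mul hk)).sub (hst.mul hinv)
  rw [zero_mul, mul_zero, sub_zero, sub_zero] at hmain
  refine hmain.congr' ?_
  filter_upwards [hk'.eventually_gt_atTop 0, eventually_gt_atTop 0] with n hk0 hn
  have hk0' : (0 : ℝ) < ⌊a * n⌋₊ := by exact_mod_cast hk0
  have hn' : (0 : ℝ) < n := by exact_mod_cast hn
  have hs := Stirling.log_stirlingSeq_formula ⌊a * n⌋₊
  rw [Real.log_div hk0'.ne' (Real.exp_pos 1).ne', Real.log_exp] at hs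
  simp only [Function.comp]
  rw [Real.log_div hk0'.ne' hn'.ne', hs]
  field_simp
  ring

section Mixture

variable {ν : Measure ℝ} [IsProbabilityMeasure ν] {τ : ℕ → Measure ℝ}

lemma mixture_closed_le {F : Set ℝ} (hF : IsClosed F) {c : ℝ≥0} {n : ℕ} (hn : n ≠ 0)
    (hν0 : ∀ᵐ γ ∂ν, 0 ≤ γ)
    (hτ : τ n F = ∫⁻ γ, poissonMeasure (n * γ.toNNReal) {k : ℕ | (k : ℝ) / n ∈ F} ∂ν)
    (hc : ∀ γ ∈ attainable (fun _ => ν), ∀ b ∈ F, (c : ℝ≥0∞) < ell γ b) :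
    τ n F ≤ ENNReal.ofReal (Real.exp (Real.log 2 - n * c)) := by
  have h2 : Real.exp (Real.log 2 - n * c) = 2 * Real.exp (-(n * c)) := by
    rw [sub_eq_add_neg, Real.exp_add, Real.exp_log two_pos]
  rw [hτ, h2]
  calc ∫⁻ γ, poissonMeasure (n * γ.toNNReal) {k : ℕ | (k : ℝ) / n ∈ F} ∂ν
      ≤ ∫⁻ _, ENNReal.ofReal (2 * Real.exp (-(n * c))) ∂ν := by
        refine lintegral_mono_ae ?_
        filter_upwards [hν0, Measure.support_mem_ae] with γ h0 hs
        lift γ to ℝ≥0 using h0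
        rw [Real.toNNReal_coe, ← ofReal_measureReal]
        exact ENNReal.ofReal_le_ofReal
          (poisson_closed_le γ hn hF (hc γ (mem_attainable_const.2 hs)))
    _ = _ := by simp

/-- Only the parameters in `A` and the single atom `k / n` are kept; the cost `log ν(A)` does not
grow with `n`. -/
lemma le_mixture {G : Set ℝ} {n k : ℕ} {y : ℝ} {A : Set ℝ} (hA : MeasurableSet A)
    (hν0 : ∀ᵐ γ ∂ν, 0 ≤ γ) (hνA : 0 < ν A)
    (hτ : τ n G = ∫⁻ γ, poissonMeasure (n * γ.toNNReal) {k : ℕ | (k : ℝ) / n ∈ G} ∂ν)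
    (hk : (k : ℝ) / n ∈ G)
    (hy : ∀ γ : ℝ≥0, (γ : ℝ) ∈ A →
      Real.exp y ≤ Real.exp (-(n * γ)) * (n * γ) ^ k / k.factorial) :
    ENNReal.ofReal (Real.exp (y + Real.log (ν.real A))) ≤ τ n G := by
  rw [hτ, Real.exp_add, ENNReal.ofReal_mul (Real.exp_nonneg _), ofReal_exp_log_real hνA]
  calc ENNReal.ofReal (Real.exp y) * ν A = ∫⁻ _ in A, ENNReal.ofReal (Real.exp y) ∂ν := by simp
    _ ≤ ∫⁻ γ in A, poissonMeasure (n * γ.toNNReal) {k : ℕ | (k : ℝ) / n ∈ G} ∂ν := by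
        refine lintegral_mono_ae ?_
        filter_upwards [ae_restrict_of_ae hν0, ae_restrict_mem hA] with γ h0 hmem
        lift γ to ℝ≥0 using h0
        rw [Real.toNNReal_coe]
        refine le_trans ?_ (measure_mono (s := {k}) (by simpa using hk))
        rw [poissonMeasure_singleton]
        refine ENNReal.ofReal_le_ofReal ((hy γ hmem).trans (le_of_eq ?_))
        push_cast
        rfl
    _ ≤ _ := setLIntegral_le_lintegral _ _

/-- The lower bound at a point `a` and a parameter `γ`. -/
lemma mixture_open_ge {G : Set ℝ} (hG : IsOpen G) (hν0 : ∀ᵐ γ ∂ν, 0 ≤ γ)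
    (hτ : ∀ n, n ≠ 0 →
      τ n G = ∫⁻ γ, poissonMeasure (n * γ.toNNReal) {k : ℕ | (k : ℝ) / n ∈ G} ∂ν)
    {γ c : ℝ≥0} (hγ : γ ∈ attainable (fun _ => ν)) {a : ℝ} (ha : a ∈ G)
    (hc : ell γ a < (c : ℝ≥0∞)) :
    ((-(c : ℝ) : ℝ) : EReal)
      ≤ liminf (fun n : ℕ => ((1 / (n : ℝ) : ℝ) : EReal) * ENNReal.log (τ n G)) atTop := by
  have hpos : ∀ δ > 0, 0 < ν (Metric.ball (γ : ℝ) δ) := fun δ hδ => (hγ δ hδ).choose_spec _ le_rfl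
  obtain ⟨d, hd1, hd2⟩ := exists_between hc
  lift d to ℝ≥0 using (hd2.trans ENNReal.coe_lt_top).ne
  have hdc : (d : ℝ) < c := by exact_mod_cast hd2
  have hθ := fun θ => le_of_ell_lt hd1.le θ
  -- negative values are impossible
  have ha0 : 0 ≤ a := by
    by_contra hneg
    push Not at hneg
    -- This `θ` is negative and makes `θ a = d + 1`, while `-γ (exp θ - 1) ≥ 0`, contradicting the
    -- bound `d`.
    have h1 := hθ ((d + 1) / a)
    rw [div_mul_cancel₀ _ hneg.ne] at h1
    have h2 : Real.exp (((d : ℝ) + 1) / a) ≤ 1 :=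
      Real.exp_le_one_iff.2 (div_nonpos_of_nonneg_of_nonpos (by positivity) hneg.le)
    have h3 : (γ : ℝ) * (Real.exp (((d : ℝ) + 1) / a) - 1) ≤ 0 :=
      mul_nonpos_of_nonneg_of_nonpos γ.2 (by linarith)
    linarith
  rcases ha0.eq_or_lt with rfl | ha0
  · -- no jobs at all
    -- Letting `θ → -∞` shows that `ℓ(γ; 0)` is at least `γ`.
    have hγd : (γ : ℝ) ≤ d := by
      have h1 : Tendsto (fun θ : ℝ => θ * 0 - (γ : ℝ) * (Real.exp θ - 1)) atBot
          (𝓝 (0 - γ * (0 - 1))) := by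
        simp only [mul_zero]
        exact tendsto_const_nhds.sub (tendsto_const_nhds.mul
          (Real.tendsto_exp_atBot.sub tendsto_const_nhds))
      have := le_of_tendsto' h1 hθ
      linarith
    set δ : ℝ := c - d with hδdef
    have hδ : 0 < δ := sub_pos.2 hdc
    have hlim : Tendsto (fun n : ℕ => (-(n * (c : ℝ)) +
        Real.log (ν.real (Metric.ball (γ : ℝ) δ))) / n) atTop (𝓝 (-c)) := by
      have h1 := (tendsto_const_div_atTop_nhds_zero_nat
        (Real.log (ν.real (Metric.ball (γ : ℝ) δ)))).const_add (-(c : ℝ))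
      rw [add_zero] at h1
      refine h1.congr' ?_
      filter_upwards [eventually_ne_atTop 0] with n hn
      field_simp
    refine le_liminf_log_of_eventually_exp_le ?_ hlim
    filter_upwards [eventually_ne_atTop 0] with n hn
    refine le_mixture (k := 0) measurableSet_ball hν0 (hpos δ hδ) (hτ n hn) (by simpa using ha)
      fun γ' hγ' => ?_
    rw [Metric.mem_ball, Real.dist_eq, abs_lt] at hγ'
    simp only [pow_zero, mul_one, Nat.factorial_zero, Nat.cast_one, div_one]
    refine Real.exp_le_exp.2 (neg_le_neg (mul_le_mul_of_nonneg_left ?_ (by positivity)))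
    linarith [hγ'.2]
  -- the parameter is positive
  have hγ0 : 0 < (γ : ℝ) := by
    rcases γ.2.eq_or_lt with h | h
    · have h1 := hθ ((d + 1) / a)
      have hz : (γ : ℝ) = 0 := h.symm
      rw [div_mul_cancel₀ _ ha0.ne', hz] at h1
      linarith
    · exact h
  have hval : a * Real.log a - a * Real.log γ - a + γ ≤ d := by
    -- The maximizer of the Legendre transform.
    have h1 := hθ (Real.log (a / γ))
    rw [Real.exp_log (by positivity), Real.log_div ha0.ne' hγ0.ne'] at h1
    have h2 : (γ : ℝ) * (a / γ - 1) = a - γ := by field_simp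
    linarith
  -- On the ball of radius `δ` the atom is at least `exp (-n(γ + δ)) (n(γ - δ))ᵏ / k!`. For small
  -- `δ` the loss compared with `γ` itself is less than the gap `c - d`.
  obtain ⟨δ, hδ0, hδγ, hδ⟩ : ∃ δ : ℝ, 0 < δ ∧ δ < γ ∧
      -(c : ℝ) < -(γ + δ) + (a * Real.log (γ - δ) + (a - a * Real.log a)) := by
    have hcont : Tendsto (fun δ : ℝ => -(γ + δ) + (a * Real.log (γ - δ) + (a - a * Real.log a)))
        (𝓝[>] 0) (𝓝 (-(γ + 0) + (a * Real.log (γ - 0) + (a - a * Real.log a)))) := by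
      refine tendsto_nhdsWithin_of_tendsto_nhds (ContinuousAt.tendsto (x := (0 : ℝ)) ?_)
      have : (γ : ℝ) - 0 ≠ 0 := by simpa using hγ0.ne'
      fun_prop (disch := exact this)
    have hlt : -(c : ℝ) < -(γ + 0) + (a * Real.log (γ - 0) + (a - a * Real.log a)) := by
      simp only [add_zero, sub_zero]; linarith
    obtain ⟨δ, h1, h2, h3⟩ := ((hcont.eventually (lt_mem_nhds hlt)).and
      ((Ioo_mem_nhdsGT hγ0 : Set.Ioo (0 : ℝ) γ ∈ 𝓝[>] 0))).exists
    exact ⟨δ, h2, h3, h1⟩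
  have hγδ : 0 < (γ : ℝ) - δ := sub_pos.2 hδγ
  have hk : Tendsto (fun n : ℕ => (⌊a * n⌋₊ : ℝ) / n) atTop (𝓝 a) :=
    (tendsto_nat_floor_mul_div_atTop ha0.le).comp tendsto_natCast_atTop_atTop
  have hlim : Tendsto (fun n : ℕ => ((-(n * (γ + δ)) + ⌊a * n⌋₊ * Real.log (γ - δ) +
      (⌊a * n⌋₊ * Real.log n - Real.log (⌊a * n⌋₊.factorial : ℝ))) +
        Real.log (ν.real (Metric.ball (γ : ℝ) δ))) / n) atTop
      (𝓝 (-(γ + δ) + (a * Real.log (γ - δ) + (a - a * Real.log a)))) := by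
    have h1 := (((hk.mul_const (Real.log (γ - δ))).add (tendsto_log_factorial ha0)).const_add
      (-((γ : ℝ) + δ))).add (tendsto_const_div_atTop_nhds_zero_nat
        (Real.log (ν.real (Metric.ball (γ : ℝ) δ))))
    rw [add_zero] at h1
    refine h1.congr' ?_
    filter_upwards [eventually_ne_atTop 0] with n hn
    field_simp
    ring
  refine le_trans (EReal.coe_le_coe_iff.2 hδ.le) (le_liminf_log_of_eventually_exp_le ?_ hlim)
  filter_upwards [eventually_gt_atTop 0, hk.eventually (hG.mem_nhds ha)] with n hn hnG
  have hn' : (0 : ℝ) < n := by exact_mod_cast hn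
  refine le_mixture (k := ⌊a * n⌋₊) measurableSet_ball hν0 (hpos δ hδ0) (hτ n hn.ne') hnG
    fun γ' hγ' => ?_
  rw [Metric.mem_ball, Real.dist_eq, abs_lt] at hγ'
  have hf : (0 : ℝ) < (⌊a * n⌋₊.factorial : ℝ) := by exact_mod_cast Nat.factorial_pos _
  have e1 : Real.exp (-(n * (γ + δ)) + ⌊a * n⌋₊ * Real.log (γ - δ) +
      (⌊a * n⌋₊ * Real.log n - Real.log (⌊a * n⌋₊.factorial : ℝ)))
      = Real.exp (-(n * (γ + δ))) * (n * (γ - δ)) ^ ⌊a * n⌋₊ / (⌊a * n⌋₊.factorial : ℝ) := by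
    rw [Real.exp_add, Real.exp_add, Real.exp_sub, Real.exp_log hf, mul_pow, Real.exp_nat_mul,
      Real.exp_nat_mul, Real.exp_log hγδ, Real.exp_log hn']
    ring
  rw [e1]
  gcongr
  · linarith [hγ'.2]
  · linarith [hγ'.1]

/-- The large deviations principle for mixtures of scaled Poisson distributions. -/
theorem satisfiesLDP_mixture {C : ℝ} (hν : ∀ᵐ γ ∂ν, γ ∈ Set.Icc 0 C) (hprob : ∀ n, τ n Set.univ ≤ 1)
    (hτ : ∀ n, n ≠ 0 → ∀ B, MeasurableSet B →
      τ n B = ∫⁻ γ, poissonMeasure (n * γ.toNNReal) {k : ℕ | (k : ℝ) / n ∈ B} ∂ν)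
    (hR : IsCompact (attainable (fun _ => ν))) :
    SatisfiesLDP τ (fun a => ⨅ γ ∈ attainable (fun _ => ν), ell γ a) where
  isRateFunction := lowerSemicontinuous_iInf_ell hR
  upper F hF := by
    refine EReal_le_neg_of_forall_lt
      (limsup_log_le_zero fun n => (measure_mono (Set.subset_univ _)).trans (hprob n)) fun r hr => ?_
    refine limsup_log_le_of_eventually_le_exp (x := fun n => Real.log 2 - n * r) ?_ ?_
    · filter_upwards [eventually_ne_atTop 0] with n hn
      exact mixture_closed_le hF hn (hν.mono fun γ h => h.1) (hτ n hn F hF.measurableSet)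
        fun γ hγ b hb => hr.trans_le ((iInf₂_le b hb).trans (iInf₂_le γ hγ))
    · have h1 := (tendsto_const_div_atTop_nhds_zero_nat (Real.log 2)).sub_const (r : ℝ)
      rw [zero_sub] at h1
      refine h1.congr' ?_
      filter_upwards [eventually_ne_atTop 0] with n hn
      field_simp
  lower G hG := by
    refine EReal_neg_le_of_forall_gt fun r hr => ?_
    simp only [iInf_lt_iff] at hr
    obtain ⟨a, ha, γ, hγ, h⟩ := hr
    exact mixture_open_ge hG (hν.mono fun γ h => h.1) (fun n hn => hτ n hn G hG.measurableSet)
      hγ ha h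

end Mixture

lemma isCompact_attainable_const {ν : Measure ℝ} {C : ℝ} (hν : ∀ᵐ γ ∂ν, γ ∈ Set.Icc 0 C) :
    IsCompact (attainable (fun _ => ν)) := by
  have hsub : ν.support ⊆ Set.Icc 0 C := Measure.support_subset_of_isClosed isClosed_Icc hν
  have hclosed : IsClosed (attainable (fun _ => ν)) := by
    have : attainable (fun _ => ν) = (fun γ : ℝ≥0 => (γ : ℝ)) ⁻¹' ν.support := by
      ext γ; exact mem_attainable_const
    rw [this]
    exact Measure.isClosed_support.preimage NNReal.continuous_coe
  refine (isCompact_Icc (a := (0 : ℝ≥0)) (b := C.toNNReal)).of_isClosed_subset hclosed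
    fun γ hγ => ⟨zero_le, ?_⟩
  exact NNReal.le_toNNReal_of_coe_le (hsub (mem_attainable_const.1 hγ)).2

/-! ### Paths of background processes -/

section Paths

variable {E : Type*}

/-- A right-continuous path in a discrete space has at most countably many discontinuities. -/
lemma IsCadlag.countable_not_continuousAt [TopologicalSpace E] [DiscreteTopology E]
    {f : ℝ≥0 → E} (hf : IsCadlag f) : {t | ¬ ContinuousAt f t}.Countable := by
  refine (countable_setOfPred_isolated_right_within (s := {t | ¬ ContinuousAt f t})).mono ?_
  intro t ht
  refine ⟨ht, ?_⟩
  have h1 : ∀ᶠ y in 𝓝[≥] t, f y = f t := by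
    have := (hf t).1
    rw [ContinuousWithinAt, nhds_discrete E, tendsto_pure] at this
    exact this
  have h1' : ∀ᶠ y in 𝓝[>] t, f y = f t := h1.filter_mono (nhdsWithin_mono _ Set.Ioi_subset_Ici_self)
  -- Right-continuity in a discrete space makes `f` constant on some `[t, t + ε)`, so there are no
  -- discontinuities just after `t`: each discontinuity is isolated from the right.
  have h2 : ∀ᶠ y in 𝓝[>] t, ContinuousAt f y := by
    filter_upwards [eventually_eventually_nhdsWithin.2 h1', self_mem_nhdsWithin] with y hy hty
    rw [IsOpen.nhdsWithin_eq isOpen_Ioi hty] at hy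
    rw [ContinuousAt, nhds_discrete E, tendsto_pure]
    have hyt := hy.self_of_nhds
    filter_upwards [hy] with w hw
    rw [hw, hyt]
  rw [← empty_mem_iff_bot]
  have h3 : ∀ᶠ y in 𝓝[{t | ¬ ContinuousAt f t} ∩ Set.Ioi t] t, ContinuousAt f y :=
    h2.filter_mono (nhdsWithin_mono _ Set.inter_subset_right)
  filter_upwards [h3, self_mem_nhdsWithin] with y hy hy'
  exact hy'.1 hy

lemma IsCadlag.ae_continuousAt [TopologicalSpace E] [DiscreteTopology E]
    {f : ℝ≥0 → E} (hf : IsCadlag f) :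
    ∀ᵐ s : ℝ, 0 ≤ s → ContinuousAt f s.toNNReal := by
  have h : ((fun u : ℝ≥0 => (u : ℝ)) '' {t | ¬ ContinuousAt f t}).Countable :=
    hf.countable_not_continuousAt.image _
  filter_upwards [h.ae_notMem volume] with s hs h0
  by_contra hcon
  exact hs ⟨s.toNNReal, hcon, Real.coe_toNNReal s h0⟩

/-- For each `n` the approximations take countably many values, so a process evaluated at them is
jointly measurable; they approach `s` from the right, the side on which the paths are continuous. -/
lemma exists_approx_from_right :
    ∃ (c : ℕ → ℕ → ℝ≥0) (φ : ℕ → ℝ≥0 → ℕ), (∀ n, Measurable (φ n)) ∧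
      ∀ s, Tendsto (fun n => c n (φ n s)) atTop (𝓝[≥] s) := by
  refine ⟨fun n k => ((k : ℝ≥0) + 1) / (n + 1), fun n s => ⌊s * (n + 1)⌋₊,
    fun n => Nat.measurable_floor.comp (measurable_id.mul_const _), fun s => ?_⟩
  have h1 : ∀ n : ℕ, s ≤ ((⌊s * (n + 1)⌋₊ : ℝ≥0) + 1) / (n + 1) := by
    intro n
    rw [le_div_iff₀ (by positivity)]
    exact (Nat.lt_floor_add_one _).le
  have h2 : ∀ n : ℕ, ((⌊s * (n + 1)⌋₊ : ℝ≥0) + 1) / (n + 1) ≤ s + 1 / (n + 1) := by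
    intro n
    rw [div_le_iff₀ (by positivity), add_mul, one_div, inv_mul_cancel₀ (by positivity)]
    gcongr
    exact Nat.floor_le zero_le
  refine tendsto_nhdsWithin_iff.2 ⟨?_, Eventually.of_forall h1⟩
  refine tendsto_of_tendsto_of_tendsto_of_le_of_le tendsto_const_nhds ?_ h1 h2
  have : Tendsto (fun n : ℕ => s + 1 / ((n : ℝ≥0) + 1)) atTop (𝓝 (s + 0)) :=
    tendsto_const_nhds.add tendsto_one_div_add_atTop_nhds_zero_nat
  simpa using this

/-- A right-continuous measurable process is jointly measurable. -/
lemma IsBackgroundProcess.measurable_uncurry {Ω : Type*} [MeasurableSpace Ω]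
    [PseudoMetricSpace E] [MeasurableSpace E] [BorelSpace E] {J : ℝ≥0 → Ω → E}
    (hJ : IsBackgroundProcess J) : Measurable (Function.uncurry J) := by
  obtain ⟨c, φ, hφ, hlim⟩ := exists_approx_from_right
  refine measurable_of_tendsto_metrizable
    (f := fun n (p : ℝ≥0 × Ω) => J (c n (φ n p.1)) p.2) (fun n => ?_) ?_
  · have h1 : Measurable (fun p : ℕ × Ω => J (c n p.1) p.2) :=
      measurable_from_prod_countable_right fun k => hJ.measurable (c n k)
    exact h1.comp (((hφ n).comp measurable_fst).prodMk measurable_snd)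
  · rw [tendsto_pi_nhds]
    rintro ⟨s, ω⟩
    exact ((hJ.cadlag ω s).1.tendsto).comp (hlim s)

lemma measurable_interval_integral {Ω : Type*} [MeasurableSpace Ω] {g : Ω → ℝ → ℝ} {a b : Ω → ℝ}
    (hg : Measurable (Function.uncurry g)) (ha : Measurable a) (hb : Measurable b) :
    Measurable (fun ω => ∫ r in (a ω)..(b ω), g ω r) := by
  have key : ∀ {a b : Ω → ℝ}, Measurable a → Measurable b →
      Measurable (fun ω => ∫ r in Set.Ioc (a ω) (b ω), g ω r) := by
    intro a b ha hb
    have hS : MeasurableSet {p : Ω × ℝ | a p.1 < p.2 ∧ p.2 ≤ b p.1} :=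
      (measurableSet_lt (ha.comp measurable_fst) measurable_snd).inter
        (measurableSet_le measurable_snd (hb.comp measurable_fst))
    have h1 := ((hg.indicator hS).stronglyMeasurable.integral_prod_right' (ν := volume)).measurable
    have h2 : (fun ω => ∫ r in Set.Ioc (a ω) (b ω), g ω r) = fun ω => ∫ r,
        {p : Ω × ℝ | a p.1 < p.2 ∧ p.2 ≤ b p.1}.indicator (Function.uncurry g) (ω, r) := by
      funext ω
      rw [← integral_indicator measurableSet_Ioc]
      rfl
    rw [h2]
    exact h1
  exact (key ha hb).sub (key hb ha)

lemma exists_bound_finite [Finite E] (g : E → ℝ≥0) : ∃ M : ℝ≥0, ∀ x, g x ≤ M := by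
  obtain ⟨M, hM⟩ := (Set.finite_range g).bddAbove
  exact ⟨M, fun x => hM ⟨x, rfl⟩⟩

lemma intervalIntegrable_of_measurable_bounded {g : ℝ → ℝ} (hg : Measurable g) {M : ℝ}
    (hM : ∀ s, |g s| ≤ M) (a b : ℝ) : IntervalIntegrable g volume a b := by
  rw [intervalIntegrable_iff]
  exact Measure.integrableOn_of_bounded (by simp) hg.aestronglyMeasurable
    (Eventually.of_forall fun s => hM s)

lemma integral_comp_path_nonneg (f : ℝ≥0 → E) (g : E → ℝ≥0) {s t : ℝ} (h : s ≤ t) :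
    0 ≤ ∫ r in s..t, (g (f r.toNNReal) : ℝ) :=
  intervalIntegral.integral_nonneg h fun _ _ => NNReal.coe_nonneg _

lemma phi_integrand_mem_Icc (f : ℝ≥0 → E) {lam : E → ℝ≥0} (kap mu : E → ℝ≥0) {M : ℝ≥0}
    (hM : ∀ x, lam x ≤ M) {s t : ℝ} (h : s ≤ t) :
    (lam (f s.toNNReal) : ℝ) *
      Real.exp (-((kap (f s.toNNReal) : ℝ) * ∫ r in s..t, (mu (f r.toNNReal) : ℝ)))
      ∈ Set.Icc (0 : ℝ) M := by
  refine ⟨by positivity, ?_⟩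
  have h1 : Real.exp (-((kap (f s.toNNReal) : ℝ) * ∫ r in s..t, (mu (f r.toNNReal) : ℝ))) ≤ 1 :=
    Real.exp_le_one_iff.2 (neg_nonpos.2 (mul_nonneg (NNReal.coe_nonneg _)
      (integral_comp_path_nonneg f mu h)))
  calc _ ≤ (lam (f s.toNNReal) : ℝ) * 1 := mul_le_mul_of_nonneg_left h1 (by positivity)
    _ ≤ M := by rw [mul_one]; exact_mod_cast hM _

lemma abs_exp_neg_sub_le {x y : ℝ} (hx : 0 ≤ x) (hy : 0 ≤ y) :
    |Real.exp (-x) - Real.exp (-y)| ≤ |x - y| := by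
  wlog h : x ≤ y generalizing x y
  · rw [abs_sub_comm, abs_sub_comm x]
    exact this hy hx (le_of_not_ge h)
  rw [abs_of_nonneg (sub_nonneg.2 (Real.exp_le_exp.2 (neg_le_neg h))), abs_of_nonpos (by linarith)]
  have h1 : Real.exp (-y) = Real.exp (-x) * Real.exp (x - y) := by
    rw [← Real.exp_add]; congr 1; ring
  have h2 : Real.exp (-x) ≤ 1 := Real.exp_le_one_iff.2 (by linarith)
  have h3 := Real.add_one_le_exp (x - y)
  have h4 : Real.exp (x - y) ≤ 1 := Real.exp_le_one_iff.2 (by linarith)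
  rw [h1]
  nlinarith [Real.exp_pos (-x)]

/-- A single path is a process on a one-point space, so measurability results for processes
specialize to paths. -/
lemma isBackgroundProcess_const [TopologicalSpace E] [MeasurableSpace E] {f : ℝ≥0 → E} (hf : IsCadlag f) :
    IsBackgroundProcess (fun s (_ : Unit) => f s) :=
  ⟨fun _ => measurable_const, fun _ => hf⟩

/-- The time that two paths spend in different states up to time `t`. -/
noncomputable def mismatch (f g : ℝ≥0 → E) (t : ℝ≥0) : ℝ :=
  ∫ s in (0 : ℝ)..t, open Classical in if g s.toNNReal = f s.toNNReal then 0 else 1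

lemma IsCadlag.measurable [PseudoMetricSpace E] [MeasurableSpace E] [BorelSpace E]
    {f : ℝ≥0 → E} (hf : IsCadlag f) : Measurable f :=
  (isBackgroundProcess_const hf).measurable_uncurry.comp (measurable_id.prodMk (measurable_const (a := ())))

variable {Ω : Type*} [MeasurableSpace Ω] [Finite E] [MetricSpace E] [MeasurableSpace E]
  [BorelSpace E]

lemma IsBackgroundProcess.measurable_comp {J : ℝ≥0 → Ω → E} (hJ : IsBackgroundProcess J)
    (g : E → ℝ≥0) : Measurable (fun p : Ω × ℝ => (g (J p.2.toNNReal p.1) : ℝ)) :=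
  ((measurable_of_finite g).comp (hJ.measurable_uncurry.comp
    (measurable_snd.real_toNNReal.prodMk measurable_fst))).coe_nnreal_real

lemma IsBackgroundProcess.measurable_phi {J : ℝ≥0 → Ω → E} (hJ : IsBackgroundProcess J)
    (lam kap mu : E → ℝ≥0) (t : ℝ≥0) :
    Measurable (fun ω => phi lam kap mu t (fun s => J s ω)) := by
  refine measurable_interval_integral ?_ measurable_const measurable_const
  refine (hJ.measurable_comp lam).mul (Real.measurable_exp.comp
    ((hJ.measurable_comp kap).mul ?_).neg)
  refine measurable_interval_integral (Ω := Ω × ℝ) (g := fun p r => (mu (J r.toNNReal p.1) : ℝ)) ?_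
    measurable_snd measurable_const
  exact (hJ.measurable_comp mu).comp ((measurable_fst.comp measurable_fst).prodMk measurable_snd)

lemma measurable_comp_path {f : ℝ≥0 → E} (hf : Measurable f) (g : E → ℝ≥0) :
    Measurable (fun s : ℝ => (g (f s.toNNReal) : ℝ)) :=
  ((measurable_of_finite g).comp (hf.comp measurable_real_toNNReal)).coe_nnreal_real

lemma intervalIntegrable_comp_path {f : ℝ≥0 → E} (hf : Measurable f) (g : E → ℝ≥0) (a b : ℝ) :
    IntervalIntegrable (fun s : ℝ => (g (f s.toNNReal) : ℝ)) volume a b := by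
  obtain ⟨M, hM⟩ := exists_bound_finite g
  refine intervalIntegrable_of_measurable_bounded (measurable_comp_path hf g) (M := M) (fun s => ?_) a b
  rw [abs_of_nonneg (by positivity)]
  exact_mod_cast hM _

lemma continuous_integral_comp_path {f : ℝ≥0 → E} (hf : Measurable f) (g : E → ℝ≥0) (a : ℝ) :
    Continuous (fun s => ∫ r in a..s, (g (f r.toNNReal) : ℝ)) :=
  intervalIntegral.continuous_primitive (fun a b => intervalIntegrable_comp_path hf g a b) a

lemma measurable_phi_integrand {f : ℝ≥0 → E} (hf : Measurable f) (lam kap mu : E → ℝ≥0) (t : ℝ) :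
    Measurable (fun s : ℝ => (lam (f s.toNNReal) : ℝ) *
      Real.exp (-((kap (f s.toNNReal) : ℝ) * ∫ r in s..t, (mu (f r.toNNReal) : ℝ)))) := by
  refine (measurable_comp_path hf lam).mul (Real.measurable_exp.comp
    ((measurable_comp_path hf kap).mul ?_).neg)
  have h : (fun s : ℝ => ∫ r in s..t, (mu (f r.toNNReal) : ℝ))
      = fun s => -∫ r in t..s, (mu (f r.toNNReal) : ℝ) :=
    funext fun s => intervalIntegral.integral_symm _ _
  rw [h]
  exact (continuous_integral_comp_path hf mu t).measurable.neg

lemma intervalIntegrable_phi_integrand {f : ℝ≥0 → E} (hf : Measurable f) (lam kap mu : E → ℝ≥0)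
    (t : ℝ≥0) : IntervalIntegrable (fun s : ℝ => (lam (f s.toNNReal) : ℝ) *
      Real.exp (-((kap (f s.toNNReal) : ℝ) * ∫ r in s..(t : ℝ), (mu (f r.toNNReal) : ℝ))))
      volume 0 t := by
  obtain ⟨M, hM⟩ := exists_bound_finite lam
  rw [intervalIntegrable_iff]
  refine Measure.integrableOn_of_bounded (M := M) (by simp)
    (measurable_phi_integrand hf lam kap mu t).aestronglyMeasurable ?_
  filter_upwards [ae_restrict_mem measurableSet_uIoc] with s hs
  rw [Set.uIoc_of_le (NNReal.coe_nonneg t)] at hs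
  have := phi_integrand_mem_Icc f kap mu hM hs.2
  rw [Real.norm_eq_abs, abs_of_nonneg this.1]
  exact this.2

lemma phi_mem_Icc {f : ℝ≥0 → E} (hf : Measurable f) {lam : E → ℝ≥0} (kap mu : E → ℝ≥0) {M : ℝ≥0}
    (hM : ∀ x, lam x ≤ M) (t : ℝ≥0) : phi lam kap mu t f ∈ Set.Icc (0 : ℝ) (M * t) := by
  refine ⟨intervalIntegral.integral_nonneg t.coe_nonneg fun s hs =>
    (phi_integrand_mem_Icc f kap mu hM hs.2).1, ?_⟩
  have := intervalIntegral.integral_mono_on (μ := volume) (a := 0) (b := (t : ℝ)) t.coe_nonneg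
    (intervalIntegrable_phi_integrand hf lam kap mu t) (intervalIntegrable_const (c := (M : ℝ)))
    fun s hs => (phi_integrand_mem_Icc f kap mu hM hs.2).2
  refine this.trans (le_of_eq ?_)
  simp [mul_comm]

lemma measurable_mismatch_integrand {f g : ℝ≥0 → E} (hf : Measurable f) (hg : Measurable g) :
    Measurable (fun s : ℝ => open Classical in
      if g s.toNNReal = f s.toNNReal then (0 : ℝ) else 1) :=
  Measurable.ite (measurableSet_eq_fun (hg.comp measurable_real_toNNReal)
    (hf.comp measurable_real_toNNReal)) measurable_const measurable_const

lemma intervalIntegrable_mismatch {f g : ℝ≥0 → E} (hf : Measurable f) (hg : Measurable g)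
    (a b : ℝ) : IntervalIntegrable (fun s : ℝ => open Classical in
      if g s.toNNReal = f s.toNNReal then (0 : ℝ) else 1) volume a b :=
  intervalIntegrable_of_measurable_bounded (measurable_mismatch_integrand hf hg) (M := 1)
    (fun s => by split_ifs <;> simp) a b

/-- `φₜ` is Lipschitz continuous with respect to the time spent in different states. -/
lemma abs_phi_sub_phi_le {lam kap mu : E → ℝ≥0} {M : ℝ≥0} (hl : ∀ x, lam x ≤ M)
    (hk : ∀ x, kap x ≤ M) (hm : ∀ x, mu x ≤ M) (t : ℝ≥0) {f g : ℝ≥0 → E} (hf : Measurable f)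
    (hg : Measurable g) :
    |phi lam kap mu t g - phi lam kap mu t f| ≤ (M + M ^ 3 * t) * mismatch f g t := by
  classical
  set d := mismatch f g t with hd
  have hd0 : 0 ≤ d := intervalIntegral.integral_nonneg t.coe_nonneg fun s _ => by split_ifs <;> simp
  have hwork : ∀ s ∈ Set.Icc (0 : ℝ) t, |(∫ r in s..(t : ℝ), (mu (g r.toNNReal) : ℝ)) -
      ∫ r in s..(t : ℝ), (mu (f r.toNNReal) : ℝ)| ≤ M * d := by
    intro s hs
    rw [← intervalIntegral.integral_sub (intervalIntegrable_comp_path hg mu _ _)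
      (intervalIntegrable_comp_path hf mu _ _)]
    have h1 : ∀ r : ℝ, |(mu (g r.toNNReal) : ℝ) - mu (f r.toNNReal)|
        ≤ M * (if g r.toNNReal = f r.toNNReal then (0 : ℝ) else 1) := by
      intro r
      split_ifs with h
      · simp [h]
      · rw [mul_one, abs_sub_le_iff]
        have e1 : (mu (g r.toNNReal) : ℝ) ≤ M := by exact_mod_cast hm _
        have e2 : (mu (f r.toNNReal) : ℝ) ≤ M := by exact_mod_cast hm _
        have e3 : (0 : ℝ) ≤ mu (g r.toNNReal) := NNReal.coe_nonneg _
        have e4 : (0 : ℝ) ≤ mu (f r.toNNReal) := NNReal.coe_nonneg _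
        constructor <;> linarith
    calc |∫ r in s..(t : ℝ), ((mu (g r.toNNReal) : ℝ) - mu (f r.toNNReal))|
        ≤ ∫ r in s..(t : ℝ), |(mu (g r.toNNReal) : ℝ) - mu (f r.toNNReal)| :=
          intervalIntegral.abs_integral_le_integral_abs hs.2
      _ ≤ ∫ r in s..(t : ℝ), (M : ℝ) * (if g r.toNNReal = f r.toNNReal then (0 : ℝ) else 1) :=
          intervalIntegral.integral_mono_on hs.2 ((intervalIntegrable_comp_path hg mu _ _).sub
            (intervalIntegrable_comp_path hf mu _ _)).abs
            ((intervalIntegrable_mismatch hf hg _ _).const_mul _) fun r _ => h1 r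
      _ = M * ∫ r in s..(t : ℝ), (if g r.toNNReal = f r.toNNReal then (0 : ℝ) else 1) :=
          intervalIntegral.integral_const_mul _ _
      _ ≤ M * d := by
          refine mul_le_mul_of_nonneg_left ?_ M.2
          refine intervalIntegral.integral_mono_interval hs.1 hs.2 le_rfl
            (Eventually.of_forall fun r => ?_) (intervalIntegrable_mismatch hf hg _ _)
          simp only [Pi.zero_apply]
          split_ifs <;> simp
  have hpt : ∀ s ∈ Set.Icc (0 : ℝ) t, |(lam (g s.toNNReal) : ℝ) *
      Real.exp (-((kap (g s.toNNReal) : ℝ) * ∫ r in s..(t : ℝ), (mu (g r.toNNReal) : ℝ))) -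
      (lam (f s.toNNReal) : ℝ) *
      Real.exp (-((kap (f s.toNNReal) : ℝ) * ∫ r in s..(t : ℝ), (mu (f r.toNNReal) : ℝ)))|
      ≤ M * (if g s.toNNReal = f s.toNNReal then (0 : ℝ) else 1) + M ^ 3 * d := by
    intro s hs
    -- Where the states agree, the integrands differ only through the later work, by at most `M · M
    -- · (M d)`. Where they differ, both integrands lie in `[0, M]`.
    by_cases h : g s.toNNReal = f s.toNNReal
    · rw [if_pos h, mul_zero, zero_add, h, ← mul_sub, abs_mul, abs_of_nonneg (NNReal.coe_nonneg _)]
      have e1 : (lam (f s.toNNReal) : ℝ) ≤ M := by exact_mod_cast hl _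
      have e2 : (kap (f s.toNNReal) : ℝ) ≤ M := by exact_mod_cast hk _
      have e3 := abs_exp_neg_sub_le
        (mul_nonneg (NNReal.coe_nonneg (kap (f s.toNNReal))) (integral_comp_path_nonneg g mu hs.2))
        (mul_nonneg (NNReal.coe_nonneg (kap (f s.toNNReal))) (integral_comp_path_nonneg f mu hs.2))
      rw [← mul_sub, abs_mul, abs_of_nonneg (NNReal.coe_nonneg (kap (f s.toNNReal)))] at e3
      have e4 := e3.trans (mul_le_mul e2 (hwork s hs) (abs_nonneg _) M.2)
      calc _ ≤ (M : ℝ) * (M * (M * d)) := mul_le_mul e1 e4 (abs_nonneg _) M.2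
        _ = _ := by ring
    · rw [if_neg h, mul_one]
      have e1 := phi_integrand_mem_Icc g kap mu hl hs.2
      have e2 := phi_integrand_mem_Icc f kap mu hl hs.2
      have e3 : 0 ≤ (M : ℝ) ^ 3 * d := by positivity
      rw [abs_sub_le_iff]
      constructor <;> linarith [e1.1, e1.2, e2.1, e2.2]
  rw [phi, phi, ← intervalIntegral.integral_sub (intervalIntegrable_phi_integrand hg lam kap mu t)
    (intervalIntegrable_phi_integrand hf lam kap mu t)]
  refine (intervalIntegral.abs_integral_le_integral_abs t.coe_nonneg).trans ?_
  refine (intervalIntegral.integral_mono_on t.coe_nonneg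
    ((intervalIntegrable_phi_integrand hg lam kap mu t).sub
      (intervalIntegrable_phi_integrand hf lam kap mu t)).abs
    (((intervalIntegrable_mismatch hf hg _ _).const_mul (M : ℝ)).add
      (intervalIntegrable_const (c := (M : ℝ) ^ 3 * d))) hpt).trans (le_of_eq ?_)
  rw [intervalIntegral.integral_add ((intervalIntegrable_mismatch hf hg _ _).const_mul (M : ℝ))
    intervalIntegrable_const, intervalIntegral.integral_const_mul,
    intervalIntegral.integral_const]
  simp only [smul_eq_mul, sub_zero]
  have e : ∫ s in (0 : ℝ)..t, (if g s.toNNReal = f s.toNNReal then (0 : ℝ) else 1) = d := by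
    rw [hd, mismatch]
  rw [e]
  ring

end Paths

/-! ### Transition matrices of irreducible Markov chains -/

section Transition

variable {E : Type*} [Fintype E] [DecidableEq E]

attribute [local instance] Matrix.linftyOpNormedRing
attribute [local instance] Matrix.linftyOpNormedAlgebra

lemma hasSum_matrix_exp_apply (B : Matrix E E ℝ) (x y : E) :
    HasSum (fun n : ℕ => ((n.factorial : ℝ))⁻¹ * (B ^ n) x y) (NormedSpace.exp B x y) := by
  have h := NormedSpace.exp_series_hasSum_exp' (𝕂 := ℝ) B
  have h1 := Pi.hasSum.1 (Pi.hasSum.1 h x) y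
  exact h1

lemma continuous_exp_smul_apply (Q : Matrix E E ℝ) (x y : E) :
    Continuous (fun h : ℝ => NormedSpace.exp (h • Q) x y) := by
  have h1 : Continuous (fun h : ℝ => NormedSpace.exp (h • Q)) :=
    (NormedSpace.exp_continuous (𝔸 := Matrix E E ℝ)).comp (by fun_prop)
  exact (continuous_apply y).comp ((continuous_apply x).comp h1)

lemma pow_apply_nonneg {B : Matrix E E ℝ} (hB : ∀ x y, 0 ≤ B x y) (n : ℕ) (x y : E) :
    0 ≤ (B ^ n) x y := by
  induction n generalizing y with
  | zero => rw [pow_zero, Matrix.one_apply]; split_ifs <;> norm_num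
  | succ n ih =>
    rw [pow_succ, Matrix.mul_apply]
    exact Finset.sum_nonneg fun z _ => mul_nonneg (ih z) (hB z y)

lemma exists_pow_apply_pos {B : Matrix E E ℝ} (hB : ∀ x y, 0 ≤ B x y) {x y : E}
    (h : Relation.ReflTransGen (fun u v => 0 < B u v) x y) : ∃ n, 0 < (B ^ n) x y := by
  induction h with
  | refl => exact ⟨0, by simp⟩
  | @tail z w _ hzw ih =>
    obtain ⟨n, hn⟩ := ih
    refine ⟨n + 1, ?_⟩
    rw [pow_succ, Matrix.mul_apply]
    exact Finset.sum_pos' (fun v _ => mul_nonneg (pow_apply_nonneg hB n x v) (hB v w))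
      ⟨z, Finset.mem_univ z, mul_pos hn hzw⟩

/-- The transition probabilities of an irreducible chain are positive at positive times. -/
lemma exp_smul_apply_pos {Q : Matrix E E ℝ} (hQ : IsRateMatrix Q) (hirr : IsIrreducibleRateMatrix Q)
    {h : ℝ} (hh : 0 < h) (x y : E) : 0 < NormedSpace.exp (h • Q) x y := by
  -- Uniformization: adding a large enough multiple of the identity makes all entries of `h Q`
  -- nonnegative and changes the exponential only by a positive scalar factor. Irreducibility then
  -- makes some power of `B` positive at `(x, y)`.
  set c : ℝ := ∑ z, |Q z z| with hc
  set B : Matrix E E ℝ := h • Q + (h * c) • (1 : Matrix E E ℝ) with hBdef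
  have hB : ∀ u v, 0 ≤ B u v := by
    intro u v
    simp only [hBdef, Matrix.add_apply, Matrix.smul_apply, smul_eq_mul, Matrix.one_apply]
    split_ifs with huv
    · subst huv
      have h1 : |Q u u| ≤ c := Finset.single_le_sum (f := fun z => |Q z z|)
        (fun z _ => abs_nonneg _) (Finset.mem_univ u)
      have h2 := neg_abs_le (Q u u)
      rw [mul_one, ← mul_add]
      exact mul_nonneg hh.le (by linarith)
    · simpa using mul_nonneg hh.le (hQ.nonneg u v huv)
  have hpath : Relation.ReflTransGen (fun u v => 0 < B u v) x y := by
    refine Relation.ReflTransGen.mono (fun u v huv => ?_) x y (hirr x y)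
    simp only [hBdef, Matrix.add_apply, Matrix.smul_apply, smul_eq_mul,
      Matrix.one_apply_ne huv.1, mul_zero, add_zero]
    exact mul_pos hh huv.2
  have hexpB : 0 < NormedSpace.exp B x y := by
    obtain ⟨n, hn⟩ := exists_pow_apply_pos hB hpath
    have hs := hasSum_matrix_exp_apply B x y
    refine lt_of_lt_of_le (by positivity : 0 < ((n.factorial : ℝ))⁻¹ * (B ^ n) x y) ?_
    exact le_hasSum hs n fun k _ => mul_nonneg (by positivity) (pow_apply_nonneg hB k x y)
  have hdecomp : h • Q = B + (-(h * c)) • (1 : Matrix E E ℝ) := by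
    rw [hBdef, add_assoc, ← add_smul]; simp
  have hcomm : Commute B ((-(h * c)) • (1 : Matrix E E ℝ)) :=
    (Commute.one_right B).smul_right _
  have hscal : NormedSpace.exp ((-(h * c)) • (1 : Matrix E E ℝ))
      = Real.exp (-(h * c)) • (1 : Matrix E E ℝ) := by
    have := NormedSpace.algebraMap_exp_comm (𝕂 := ℝ) (𝔸 := Matrix E E ℝ) (-(h * c))
    rw [Algebra.algebraMap_eq_smul_one, Algebra.algebraMap_eq_smul_one, ← Real.exp_eq_exp_ℝ] at this
    exact this.symm
  rw [hdecomp, Matrix.exp_add_of_commute _ _ hcomm, hscal, mul_smul_comm, mul_one,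
    Matrix.smul_apply, smul_eq_mul]
  exact mul_pos (Real.exp_pos _) hexpB

end Transition

/-! ### Markov chains follow a given path with positive probability -/

section Markov

variable {E : Type*} [Fintype E] [DecidableEq E]
  {Ω : Type*} [MeasurableSpace Ω] {P : Measure Ω} {J : ℝ≥0 → Ω → E} {Q : Matrix E E ℝ}

/-- The event that the process visits the states `x 0, …, x m` at the times `s 0, …, s m`. -/
def gridEvent (J : ℝ≥0 → Ω → E) (s : ℕ → ℝ≥0) (x : ℕ → E) (m : ℕ) : Set Ω :=
  {ω | ∀ i ≤ m, J (s i) ω = x i}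

lemma IsMarkovChainWithRates.real_gridEvent_succ (h : IsMarkovChainWithRates P J Q)
    {s : ℕ → ℝ≥0} (hs : Monotone s) (x : ℕ → E) (m : ℕ) :
    P.real (gridEvent J s x (m + 1)) = P.real (gridEvent J s x m) *
      NormedSpace.exp (((s (m + 1) : ℝ) - (s m : ℝ)) • Q) (x m) (x (m + 1)) :=
  h m s x hs

lemma IsMarkovChainWithRates.real_gridEvent_pos (h : IsMarkovChainWithRates P J Q)
    (hQ : IsRateMatrix Q) (hirr : IsIrreducibleRateMatrix Q) {s : ℕ → ℝ≥0} (hs : StrictMono s)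
    {x : ℕ → E} (h0 : 0 < P.real {ω | J (s 0) ω = x 0}) (m : ℕ) :
    0 < P.real (gridEvent J s x m) := by
  induction m with
  | zero => simpa [gridEvent] using h0
  | succ m ih =>
    rw [h.real_gridEvent_succ hs.monotone]
    refine mul_pos ih (exp_smul_apply_pos hQ hirr (sub_pos.2 ?_) _ _)
    exact_mod_cast hs (Nat.lt_succ_self m)

/-- The effect of one additional observation. -/
lemma IsMarkovChainWithRates.real_gridEvent_inter (h : IsMarkovChainWithRates P J Q)
    {s : ℕ → ℝ≥0} (hs : Monotone s) (x : ℕ → E) {j m : ℕ} (hjm : j + 1 ≤ m) {u : ℝ≥0}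
    (hu1 : s j ≤ u) (hu2 : u ≤ s (j + 1)) (y : E) :
    P.real (gridEvent J s x m ∩ {ω | J u ω = y}) *
        NormedSpace.exp (((s (j + 1) : ℝ) - (s j : ℝ)) • Q) (x j) (x (j + 1)) =
      P.real (gridEvent J s x m) * (NormedSpace.exp (((u : ℝ) - (s j : ℝ)) • Q) (x j) y *
        NormedSpace.exp (((s (j + 1) : ℝ) - (u : ℝ)) • Q) y (x (j + 1))) := by
  -- The observation `(u, y)` is inserted at index `j + 1`. The new grid is only monotone, since `u`
  -- may coincide with a neighbour; this is why the Markov property is wanted for weakly increasing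
  -- times.
  let s' : ℕ → ℝ≥0 := fun i => if i ≤ j then s i else if i = j + 1 then u else s (i - 1)
  let x' : ℕ → E := fun i => if i ≤ j then x i else if i = j + 1 then y else x (i - 1)
  have hs1 : ∀ i ≤ j, s' i = s i := fun i hi => by simp [s', hi]
  have hx1 : ∀ i ≤ j, x' i = x i := fun i hi => by simp [x', hi]
  have hs2 : s' (j + 1) = u := by simp [s']
  have hx2 : x' (j + 1) = y := by simp [x']
  have hs3 : ∀ i, j + 1 ≤ i → s' (i + 1) = s i := fun i hi => by
    simp [s', show ¬ (i + 1 ≤ j) by omega, show i ≠ j by omega]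
  have hx3 : ∀ i, j + 1 ≤ i → x' (i + 1) = x i := fun i hi => by
    simp [x', show ¬ (i + 1 ≤ j) by omega, show i ≠ j by omega]
  have hs' : Monotone s' := by
    refine monotone_nat_of_le_succ fun i => ?_
    rcases lt_trichotomy i j with hi | rfl | hi
    · rw [hs1 i hi.le, hs1 (i + 1) hi]; exact hs (Nat.le_succ i)
    · rw [hs1 i le_rfl, hs2]; exact hu1
    · rcases (Nat.succ_le_of_lt hi).eq_or_lt with rfl | hi'
      · rw [hs3 _ le_rfl, Nat.succ_eq_add_one, hs2]; exact hu2
      · obtain ⟨k, rfl⟩ : ∃ k, i = k + 1 := ⟨i - 1, by omega⟩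
        rw [hs3 k (by omega), hs3 (k + 1) (by omega)]
        exact hs (Nat.le_succ k)
  have hev : ∀ m, j + 1 ≤ m →
      gridEvent J s x m ∩ {ω | J u ω = y} = gridEvent J s' x' (m + 1) := by
    intro m hm
    ext ω
    simp only [gridEvent, Set.mem_inter_iff, Set.mem_ofPred_eq]
    constructor
    · rintro ⟨h1, h2⟩ i hi
      rcases lt_trichotomy i (j + 1) with hi' | rfl | hi'
      · rw [hs1 i (by omega), hx1 i (by omega)]; exact h1 i (by omega)
      · rw [hs2, hx2]; exact h2
      · obtain ⟨k, rfl⟩ : ∃ k, i = k + 1 := ⟨i - 1, by omega⟩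
        rw [hs3 k (by omega), hx3 k (by omega)]; exact h1 k (by omega)
    · intro h1
      refine ⟨fun i hi => ?_, ?_⟩
      · rcases Nat.lt_or_ge j i with hi' | hi'
        · have := h1 (i + 1) (by omega)
          rwa [hs3 i hi', hx3 i hi'] at this
        · have := h1 i (by omega)
          rwa [hs1 i hi', hx1 i hi'] at this
      · have := h1 (j + 1) (by omega)
        rwa [hs2, hx2] at this
  have hbase : gridEvent J s' x' j = gridEvent J s x j := by
    ext ω
    refine forall₂_congr fun i hi => ?_
    rw [hs1 i hi, hx1 i hi]
  induction m, hjm using Nat.le_induction with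
  | base =>
    rw [hev _ le_rfl, h.real_gridEvent_succ hs', h.real_gridEvent_succ hs', hbase,
      h.real_gridEvent_succ hs, hs2, hx2, hs3 _ le_rfl, hx3 _ le_rfl, hs1 j le_rfl, hx1 j le_rfl]
    ring
  | succ m hm ih =>
    rw [hev m hm] at ih
    rw [hev (m + 1) (by omega), h.real_gridEvent_succ hs', h.real_gridEvent_succ hs,
      hs3 (m + 1) (by omega), hx3 (m + 1) (by omega), hs3 m hm, hx3 m hm]
    -- Observations after index `j + 1` multiply both sides by the same transition probability.
    linear_combination (NormedSpace.exp (((s (m + 1) : ℝ) - (s m : ℝ)) • Q) (x m) (x (m + 1))) * ih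

lemma measurableSet_gridEvent {E : Type*} [Finite E] [MetricSpace E] [MeasurableSpace E]
    [BorelSpace E] {J : ℝ≥0 → Ω → E} (hJ : IsBackgroundProcess J) (s : ℕ → ℝ≥0) (x : ℕ → E) (m : ℕ) :
    MeasurableSet (gridEvent J s x m) := by
  have : gridEvent J s x m = ⋂ i, ⋂ (_ : i ≤ m), {ω | J (s i) ω = x i} := by
    ext ω; simp [gridEvent]
  rw [this]
  exact MeasurableSet.iInter fun i => MeasurableSet.iInter fun _ =>
    hJ.measurable (s i) (measurableSet_singleton (x i))

/-- The initial distribution is arbitrary, so the chain may be unable to start where the target path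
does; some state of positive initial mass has to serve instead. -/
lemma exists_initial_state {E : Type*} [Finite E] (P : Measure Ω) [IsProbabilityMeasure P]
    (J : ℝ≥0 → Ω → E) : ∃ y, 0 < P.real {ω | J 0 ω = y} := by
  by_contra! hcon
  have h1 : ∀ y, P {ω | J 0 ω = y} = 0 := fun y => by
    have := le_antisymm (hcon y) measureReal_nonneg
    rwa [measureReal_eq_zero_iff] at this
  have h2 : P (⋃ y, {ω | J 0 ω = y}) = 0 := measure_iUnion_null h1
  have h3 : (⋃ y, {ω | J 0 ω = y}) = Set.univ := by
    ext ω; simp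
  rw [h3, measure_univ] at h2
  exact one_ne_zero h2

variable [IsProbabilityMeasure P] [MetricSpace E] [MeasurableSpace E] [BorelSpace E]

/-- An irreducible Markov chain spends, with positive probability, an arbitrarily small time in
states different from those of a given path. -/
lemma IsIrreducibleMarkovChain.measure_mismatch_pos (hM : IsIrreducibleMarkovChain P J)
    (hJ : IsBackgroundProcess J) {f : ℝ≥0 → E} (hf : IsCadlag f) (t : ℝ≥0) {δ : ℝ} (hδ : 0 < δ) :
    0 < P {ω | mismatch f (fun s => J s ω) t < δ} := by
  obtain ⟨Q, hQ, hirr, h⟩ := hM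
  obtain ⟨y₀, hy₀⟩ := exists_initial_state P J
  -- The chain is conditioned to agree with `f` on a grid of mesh `1 / (N + 1)`, except at time `0`,
  -- where it starts in `y₀`. The grid extends past `t` so that every `u ≤ t` has a right neighbour
  -- on it.
  let s : ℕ → ℕ → ℝ≥0 := fun N i => (i : ℝ≥0) / (N + 1)
  let x : ℕ → ℕ → E := fun N i => if i = 0 then y₀ else f (s N i)
  let m : ℕ → ℕ := fun N => (⌈t⌉₊ + 1) * (N + 1)
  have hs : ∀ N, StrictMono (s N) := fun N i j hij => by
    simp only [s]
    gcongr
  let A : ℕ → Set Ω := fun N => gridEvent J (s N) (x N) (m N)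
  have hA : ∀ N, MeasurableSet (A N) := fun N => measurableSet_gridEvent hJ _ _ _
  have hApos : ∀ N, 0 < P.real (A N) := fun N =>
    h.real_gridEvent_pos hQ hirr (hs N) (by simpa [s, x] using hy₀) _
  have hA0 : ∀ N, P (A N) ≠ 0 := fun N h0 => by
    have := hApos N
    rw [Measure.real, h0] at this
    simp at this
  have hprob : ∀ N, IsProbabilityMeasure (P[|A N]) := fun N => cond_isProbabilityMeasure (hA0 N)
  let B : ℝ → Set Ω := fun u => {ω | J u.toNNReal ω ≠ f u.toNNReal}
  have hBprod : MeasurableSet {p : ℝ × Ω | J p.1.toNNReal p.2 ≠ f p.1.toNNReal} := by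
    refine (measurableSet_eq_fun ?_ ?_).compl
    · exact hJ.measurable_uncurry.comp
        ((measurable_real_toNNReal.comp measurable_fst).prodMk measurable_snd)
    · exact hf.measurable.comp (measurable_real_toNNReal.comp measurable_fst)
  have hB : ∀ u, MeasurableSet (B u) := fun u => measurable_prodMk_left hBprod
  have hpt : ∀ u : ℝ, 0 < u → u ≤ t → ContinuousAt f u.toNNReal →
      Tendsto (fun N => P[|A N] (B u)) atTop (𝓝 0) := by
    intro u hu0 hut hcont
    set v := u.toNNReal with hv
    have hv0 : 0 < v := Real.toNNReal_pos.2 hu0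
    have hvt : v ≤ t := Real.toNNReal_le_iff_le_coe.2 hut
    set j : ℕ → ℕ := fun N => ⌊v * (N + 1)⌋₊ with hj
    have hlow : ∀ N, s N (j N) ≤ v := fun N => by
      simp only [s, j]
      rw [div_le_iff₀ (by positivity)]
      exact Nat.floor_le zero_le
    have hhigh : ∀ N, v ≤ s N (j N + 1) := fun N => by
      simp only [s, j]
      rw [le_div_iff₀ (by positivity)]
      push_cast
      exact (Nat.lt_floor_add_one _).le
    have hdiff : ∀ N, (s N (j N + 1) : ℝ) - s N (j N) = 1 / (N + 1) := fun N => by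
      simp only [s]
      push_cast
      ring
    have hone : Tendsto (fun N : ℕ => (1 : ℝ) / (N + 1)) atTop (𝓝 0) :=
      tendsto_one_div_add_atTop_nhds_zero_nat
    have ha : Tendsto (fun N => (v : ℝ) - s N (j N)) atTop (𝓝 0) := by
      refine squeeze_zero (fun N => ?_) (fun N => ?_) hone
      · exact sub_nonneg.2 (by exact_mod_cast hlow N)
      · rw [← hdiff N]
        have : (v : ℝ) ≤ s N (j N + 1) := by exact_mod_cast hhigh N
        linarith
    have hb : Tendsto (fun N => (s N (j N + 1) : ℝ) - v) atTop (𝓝 0) := by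
      refine squeeze_zero (fun N => ?_) (fun N => ?_) hone
      · exact sub_nonneg.2 (by exact_mod_cast hhigh N)
      · rw [← hdiff N]
        have : (s N (j N) : ℝ) ≤ v := by exact_mod_cast hlow N
        linarith
    have hsl : Tendsto (fun N => s N (j N)) atTop (𝓝 v) := by
      rw [← NNReal.tendsto_coe]
      simpa using (tendsto_const_nhds (x := (v : ℝ))).sub ha
    have hsr : Tendsto (fun N => s N (j N + 1)) atTop (𝓝 v) := by
      rw [← NNReal.tendsto_coe]
      simpa using hb.add_const (v : ℝ)
    have hcont' : ∀ᶠ w in 𝓝 v, f w = f v := by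
      have := hcont
      rw [ContinuousAt, nhds_discrete E, tendsto_pure] at this
      exact this
    -- At index `0` the prescribed state is `y₀` and not `f 0`.
    have hj1 : ∀ᶠ N in atTop, j N ≠ 0 := by
      have : ∀ᶠ N in atTop, 0 < s N (j N) := hsl.eventually (lt_mem_nhds hv0)
      filter_upwards [this] with N hN h0
      rw [h0] at hN
      simp [s] at hN
    have hp0 : ∀ z, NormedSpace.exp ((0 : ℝ) • Q) z z = 1 := fun z => by
      rw [zero_smul, NormedSpace.exp_zero, Matrix.one_apply_eq]
    have htend : ∀ {r : ℕ → ℝ}, Tendsto r atTop (𝓝 0) →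
        Tendsto (fun N => NormedSpace.exp (r N • Q) (f v) (f v)) atTop (𝓝 1) := fun hr => by
      rw [← hp0 (f v)]
      exact ((continuous_exp_smul_apply Q (f v) (f v)).tendsto 0).comp hr
    have hreal : Tendsto (fun N => (P[|A N]).real (B u)) atTop (𝓝 0) := by
      -- Between two grid points with common state `w = f v`, the conditional probability of being
      -- in `w` at time `v` is the bridge probability `p_a(w,w) p_b(w,w) / p_{a+b}(w,w)`, which
      -- tends to `1` as the mesh `a + b` tends to `0`.
      have hlim : Tendsto (fun N : ℕ => 1 -
          (NormedSpace.exp (((v : ℝ) - s N (j N)) • Q) (f v) (f v) *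
          NormedSpace.exp (((s N (j N + 1) : ℝ) - v) • Q) (f v) (f v)) /
          NormedSpace.exp (((1 : ℝ) / (N + 1)) • Q) (f v) (f v)) atTop (𝓝 (1 - 1 * 1 / 1)) :=
        tendsto_const_nhds.sub (((htend ha).mul (htend hb)).div (htend hone) one_ne_zero)
      rw [show (1 : ℝ) - 1 * 1 / 1 = 0 by norm_num] at hlim
      refine hlim.congr' ?_
      filter_upwards [hsl.eventually hcont', hsr.eventually hcont', hj1] with N h1 h2 h3
      have hjm : j N + 1 ≤ m N := by
        have e1 : j N < ⌊v * (N + 1)⌋₊ + 1 := Nat.lt_succ_self _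
        have e2 : v * (N + 1) ≤ ((⌈t⌉₊ * (N + 1) : ℕ) : ℝ≥0) := by
          push_cast
          gcongr
          exact hvt.trans (Nat.le_ceil t)
        have e3 : ⌊v * (N + 1)⌋₊ ≤ ⌈t⌉₊ * (N + 1) := Nat.floor_le_of_le e2
        simp only [m, add_mul, one_mul]
        omega
      have hx1 : x N (j N) = f v := by simp [x, h3, h1]
      have hx2 : x N (j N + 1) = f v := by simp [x, h2]
      have hins := h.real_gridEvent_inter (hs N).monotone (x N) hjm (hlow N) (hhigh N) (f v)
      rw [hx1, hx2, hdiff N] at hins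
      have hcompl : B u = {ω | J v ω = f v}ᶜ := rfl
      have hmeas : MeasurableSet {ω | J v ω = f v} :=
        hJ.measurable v (measurableSet_singleton _)
      have hppos : 0 < NormedSpace.exp (((1 : ℝ) / (N + 1)) • Q) (f v) (f v) :=
        exp_smul_apply_pos hQ hirr (by positivity) _ _
      have hc : (P[|A N]).real {ω | J v ω = f v}
          = (P.real (A N))⁻¹ * P.real (A N ∩ {ω | J v ω = f v}) := by
        rw [Measure.real, cond_apply (hA N), ENNReal.toReal_mul, ENNReal.toReal_inv]
        rfl
      rw [hcompl, probReal_compl_eq_one_sub hmeas, hc]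
      congr 1
      have hAN := hApos N
      rw [div_eq_iff hppos.ne', mul_assoc]
      change _ = (P.real (A N))⁻¹ * (P.real (gridEvent J (s N) (x N) (m N) ∩ _) * _)
      rw [hins]
      change _ = (P.real (A N))⁻¹ * (P.real (A N) * _)
      field_simp
    have := ENNReal.tendsto_ofReal hreal
    rw [ENNReal.ofReal_zero] at this
    refine this.congr fun N => ?_
    rw [Measure.real, ENNReal.ofReal_toReal (measure_ne_top _ _)]
  -- By Tonelli this integral is the conditional expected mismatch. Were the mismatch almost surely
  -- at least `δ` under `P`, it would be so under each conditional law too, and the integral could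
  -- not tend to `0`.
  have hint : Tendsto (fun N => ∫⁻ u in Set.Ioc (0 : ℝ) t, P[|A N] (B u)) atTop (𝓝 0) := by
    have := tendsto_lintegral_of_dominated_convergence
      (μ := volume.restrict (Set.Ioc (0 : ℝ) t)) (F := fun N u => P[|A N] (B u)) (f := fun _ => 0)
      (fun _ => 1) (fun N => measurable_measure_prodMk_left (ν := P[|A N]) hBprod)
      (fun N => Eventually.of_forall fun u => prob_le_one) (by simp) ?_
    · simpa using this
    · filter_upwards [ae_restrict_mem measurableSet_Ioc, ae_restrict_of_ae hf.ae_continuousAt]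
        with u hu hc
      exact hpt u hu.1 hu.2 (hc hu.1.le)
  by_contra hcon
  have hzero : P {ω | mismatch f (fun s => J s ω) t < δ} = 0 := by simpa using hcon
  have hge : ∀ᵐ ω ∂P, ENNReal.ofReal δ
      ≤ volume.restrict (Set.Ioc (0 : ℝ) t) {u | J u.toNNReal ω ≠ f u.toNNReal} := by
    have h1 : ∀ᵐ ω ∂P, ¬ (mismatch f (fun s => J s ω) t < δ) := by
      rw [ae_iff]; simpa using hzero
    filter_upwards [h1] with ω hω
    push Not at hω
    have hmeas : MeasurableSet {u : ℝ | J u.toNNReal ω ≠ f u.toNNReal} :=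
      measurable_prodMk_right hBprod
    have h2 : mismatch f (fun s => J s ω) t =
        (volume.restrict (Set.Ioc (0 : ℝ) t)).real {u : ℝ | J u.toNNReal ω ≠ f u.toNNReal} := by
      rw [mismatch, intervalIntegral.integral_of_le t.coe_nonneg, ← integral_indicator_one hmeas]
      refine integral_congr_ae (Eventually.of_forall fun u => ?_)
      by_cases hu : J u.toNNReal ω = f u.toNNReal <;> simp [hu, Set.indicator]
    rw [h2] at hω
    exact ENNReal.ofReal_le_of_le_toReal hω
  have hcontr : ∀ N, ENNReal.ofReal δ ≤ ∫⁻ u in Set.Ioc (0 : ℝ) t, P[|A N] (B u) := by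
    intro N
    have h1 : ∫⁻ u in Set.Ioc (0 : ℝ) t, P[|A N] (B u) = ∫⁻ ω,
        volume.restrict (Set.Ioc (0 : ℝ) t) {u | J u.toNNReal ω ≠ f u.toNNReal} ∂(P[|A N]) := by
      have e1 := Measure.prod_apply (μ := volume.restrict (Set.Ioc (0 : ℝ) t)) (ν := P[|A N]) hBprod
      have e2 := Measure.prod_apply_symm (μ := volume.restrict (Set.Ioc (0 : ℝ) t)) (ν := P[|A N])
        hBprod
      exact e1.symm.trans e2
    rw [h1]
    calc ENNReal.ofReal δ = ∫⁻ _, ENNReal.ofReal δ ∂(P[|A N]) := by simp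
      _ ≤ _ := lintegral_mono_ae (cond_absolutelyContinuous.ae_le hge)
  have := ge_of_tendsto' hint hcontr
  simp only [nonpos_iff_eq_zero, ENNReal.ofReal_eq_zero] at this
  linarith

/-- Every parameter that is attainable for some background process is attainable for an irreducible
Markov chain. -/
lemma attainable_subset_of_isIrreducibleMarkovChain (hM : IsIrreducibleMarkovChain P J)
    (hJ : IsBackgroundProcess J) {Ω' : Type*} [MeasurableSpace Ω'] {P' : Measure Ω'}
    {J' : ℝ≥0 → Ω' → E} (hJ' : IsBackgroundProcess J') (lam kap mu : E → ℝ≥0) (t : ℝ≥0) :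
    attainable (fun _ => paramLaw P' J' lam kap mu t) ⊆
      attainable (fun _ => paramLaw P J lam kap mu t) := by
  intro γ hγ ε hε
  refine ⟨0, fun n _ => ?_⟩
  obtain ⟨N, hN⟩ := hγ (ε / 2) (half_pos hε)
  have h1 := hN N le_rfl
  rw [paramLaw, Measure.map_apply (hJ'.measurable_phi lam kap mu t) measurableSet_ball] at h1
  obtain ⟨ω', hω'⟩ := nonempty_of_measure_ne_zero h1.ne'
  obtain ⟨M₁, hM₁⟩ := exists_bound_finite lam
  obtain ⟨M₂, hM₂⟩ := exists_bound_finite kap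
  obtain ⟨M₃, hM₃⟩ := exists_bound_finite mu
  set M := max M₁ (max M₂ M₃) with hMdef
  have hf := hJ'.cadlag ω'
  set C : ℝ := M + M ^ 3 * t with hC
  have hC0 : 0 ≤ C := by positivity
  -- Half of `ε` pays for the distance of `φₜ(f)` from `γ`, the other half for the mismatch. The `+
  -- 1` covers a vanishing Lipschitz constant.
  have hpos := hM.measure_mismatch_pos hJ hf t (δ := ε / 2 / (C + 1)) (by positivity)
  rw [paramLaw, Measure.map_apply (hJ.measurable_phi lam kap mu t) measurableSet_ball]
  refine hpos.trans_le (measure_mono fun ω hω => ?_)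
  have h2 := abs_phi_sub_phi_le (lam := lam) (kap := kap) (mu := mu) (M := M)
    (fun x => (hM₁ x).trans (le_max_left _ _))
    (fun x => (hM₂ x).trans ((le_max_left _ _).trans (le_max_right _ _)))
    (fun x => (hM₃ x).trans ((le_max_right _ _).trans (le_max_right _ _))) t
    hf.measurable (hJ.cadlag ω).measurable
  have h3 : C * mismatch (fun s => J' s ω') (fun s => J s ω) t ≤ ε / 2 := by
    have h4 : mismatch (fun s => J' s ω') (fun s => J s ω) t ≤ ε / 2 / (C + 1) := le_of_lt hω
    calc _ ≤ C * (ε / 2 / (C + 1)) := mul_le_mul_of_nonneg_left h4 hC0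
      _ = (ε / 2) * (C / (C + 1)) := by ring
      _ ≤ (ε / 2) * 1 := by
        refine mul_le_mul_of_nonneg_left ?_ (by positivity)
        rw [div_le_one (by positivity)]
        linarith
      _ = ε / 2 := mul_one _
  rw [Set.mem_preimage, Metric.mem_ball, Real.dist_eq] at hω' ⊢
  have h5 := abs_sub_le (phi lam kap mu t fun s => J s ω) (phi lam kap mu t fun s => J' s ω') γ
  linarith

end Markov

/-! ### Thinned Poisson processes -/

/-! ### An integral identity for exponential waiting times -/

section FixedPoint

lemma hasDerivAt_exp_primitive_ae {k : ℝ → ℝ} (hk : Measurable k) {K : ℝ} (hK : ∀ u, |k u| ≤ K)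
    (a : ℝ) : ∀ᵐ u, HasDerivAt (fun u => Real.exp (∫ r in a..u, k r))
      (k u * Real.exp (∫ r in a..u, k r)) u := by
  have hloc : LocallyIntegrable k volume := by
    refine (locallyIntegrable_const K).mono hk.aestronglyMeasurable (Eventually.of_forall fun u => ?_)
    exact (hK u).trans (le_abs_self K)
  filter_upwards [_root_.LocallyIntegrable.ae_hasDerivAt_integral hloc] with u hu
  rw [mul_comm]
  exact (hu a).exp

/-- The chain rule for the exponential of an absolutely continuous function. -/
lemma integral_mul_exp_primitive {k : ℝ → ℝ} (hk : Measurable k) {K : ℝ} (hK : ∀ u, |k u| ≤ K)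
    (a b c : ℝ) : ∫ u in b..c, k u * Real.exp (∫ r in a..u, k r)
      = Real.exp (∫ r in a..c, k r) - Real.exp (∫ r in a..b, k r) := by
  have hint : ∀ x y, IntervalIntegrable k volume x y :=
    fun x y => intervalIntegrable_of_measurable_bounded hk hK x y
  -- As `k` is merely measurable and bounded, the derivative exists only almost everywhere. Absolute
  -- continuity, here from a Lipschitz bound, rescues the fundamental theorem of calculus.
  have hac : AbsolutelyContinuousOnInterval (fun u => Real.exp (∫ r in a..u, k r)) b c := by
    have hcont : Continuous (fun u => ∫ r in a..u, k r) :=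
      intervalIntegral.continuous_primitive hint a
    obtain ⟨B, hB⟩ := (isCompact_uIcc (a := b) (b := c)).bddAbove_image hcont.continuousOn
    have hB' : ∀ u ∈ Set.uIcc b c, ∫ r in a..u, k r ≤ B := fun u hu => hB ⟨u, hu, rfl⟩
    have hK0 : 0 ≤ K := (abs_nonneg _).trans (hK 0)
    refine LipschitzOnWith.absolutelyContinuousOnInterval
      (K := ⟨Real.exp B * K, by positivity⟩) (LipschitzOnWith.of_dist_le_mul fun x hx y hy => ?_)
    have hexp : ∀ p q : ℝ, p ≤ B → q ≤ B → |Real.exp p - Real.exp q| ≤ Real.exp B * |p - q| := by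
      intro p q hp hq
      have h1 := abs_exp_neg_sub_le (x := B - p) (y := B - q) (by linarith) (by linarith)
      have e1 : Real.exp p = Real.exp B * Real.exp (-(B - p)) := by rw [← Real.exp_add]; ring_nf
      have e2 : Real.exp q = Real.exp B * Real.exp (-(B - q)) := by rw [← Real.exp_add]; ring_nf
      rw [e1, e2, ← mul_sub, abs_mul, abs_of_pos (Real.exp_pos B)]
      refine mul_le_mul_of_nonneg_left (h1.trans (le_of_eq ?_)) (Real.exp_nonneg _)
      rw [abs_sub_comm p q]; congr 1; ring
    rw [Real.dist_eq, Real.dist_eq]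
    refine (hexp _ _ (hB' x hx) (hB' y hy)).trans ?_
    rw [intervalIntegral.integral_interval_sub_left (hint _ _) (hint _ _)]
    have h2 := intervalIntegral.norm_integral_le_of_norm_le_const (a := y) (b := x) (f := k) (C := K)
      fun u _ => hK u
    rw [Real.norm_eq_abs] at h2
    calc _ ≤ Real.exp B * (K * |x - y|) := mul_le_mul_of_nonneg_left h2 (Real.exp_nonneg _)
      _ = _ := by rw [← mul_assoc]; rfl
  rw [← hac.integral_deriv_eq_sub]
  refine intervalIntegral.integral_congr_ae ?_
  filter_upwards [hasDerivAt_exp_primitive_ae hk hK a] with u hu _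
  exact hu.deriv.symm

variable {h : ℝ → ℝ} {L c : ℝ}

lemma intervalIntegrable_of_mem_Icc (hh : Measurable h) (h01 : ∀ u, h u ∈ Set.Icc (0 : ℝ) 1)
    (a b : ℝ) : IntervalIntegrable h volume a b :=
  intervalIntegrable_of_measurable_bounded hh (M := 1)
    (fun u => by rw [abs_of_nonneg (h01 u).1]; exact (h01 u).2) a b

lemma integral_tail_eq_zero (hL : ∀ u, L < u → h u = 0) {v : ℝ} (hv : L ≤ v) :
    ∫ r in v..L, h r = 0 := by
  rw [intervalIntegral.integral_symm, intervalIntegral.integral_of_le hv, neg_eq_zero]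
  refine integral_eq_zero_of_ae ?_
  filter_upwards [ae_restrict_mem measurableSet_Ioc] with r hr
  exact hL r hr.1

lemma integral_tail_mem_Icc (hh : Measurable h) (h01 : ∀ u, h u ∈ Set.Icc (0 : ℝ) 1)
    (hL : ∀ u, L < u → h u = 0) (hL0 : 0 ≤ L) {v : ℝ} (hv : 0 ≤ v) :
    ∫ r in v..L, h r ∈ Set.Icc (0 : ℝ) (∫ r in (0 : ℝ)..L, h r) := by
  rcases le_total v L with hvL | hvL
  · refine ⟨intervalIntegral.integral_nonneg hvL fun r _ => (h01 r).1, ?_⟩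
    exact intervalIntegral.integral_mono_interval hv hvL le_rfl
      (Eventually.of_forall fun r => (h01 r).1) (intervalIntegrable_of_mem_Icc hh h01 _ _)
  · rw [integral_tail_eq_zero hL hvL]
    exact ⟨le_rfl, intervalIntegral.integral_nonneg hL0 fun r _ => (h01 r).1⟩

/-- The integrand is minus the derivative of `exp (-u) exp (c ∫ᵤᴸ h)`, which vanishes at infinity
because `h = 0` beyond `L`. The condition `c ≥ -1` keeps the integrand nonnegative. -/
lemma lintegral_Ioi_exp_tail (hh : Measurable h) (h01 : ∀ u, h u ∈ Set.Icc (0 : ℝ) 1)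
    (hL : ∀ u, L < u → h u = 0) (hc : -1 ≤ c) (x : ℝ) :
    ∫⁻ u in Set.Ioi x, ENNReal.ofReal
        (Real.exp (-u) * ((1 + c * h u) * Real.exp (c * ∫ r in u..L, h r)))
      = ENNReal.ofReal (Real.exp (-x) * Real.exp (c * ∫ r in x..L, h r)) := by
  set k : ℝ → ℝ := fun u => -(1 + c * h u) with hk
  have hkm : Measurable k := ((hh.const_mul c).const_add 1).neg
  have hkK : ∀ u, |k u| ≤ 1 + |c| := fun u => by
    rw [hk, abs_neg]
    refine (abs_add_le _ _).trans ?_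
    rw [abs_one, abs_mul, abs_of_nonneg (h01 u).1]
    have := mul_le_mul_of_nonneg_left (h01 u).2 (abs_nonneg c)
    linarith
  have hint := intervalIntegrable_of_mem_Icc hh h01
  have hv : ∀ u, Real.exp (∫ r in L..u, k r) =
      Real.exp L * (Real.exp (-u) * Real.exp (c * ∫ r in u..L, h r)) := by
    intro u
    have e1 : ∫ r in L..u, k r = L + (-u + c * ∫ r in u..L, h r) := by
      simp only [hk]
      rw [intervalIntegral.integral_neg, intervalIntegral.integral_add intervalIntegrable_const
        ((hint _ _).const_mul c), intervalIntegral.integral_const,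
        intervalIntegral.integral_const_mul, intervalIntegral.integral_symm u L]
      simp only [smul_eq_mul]
      ring
    rw [e1, Real.exp_add, Real.exp_add]
  set F : ℝ → ℝ := fun u =>
    Real.exp (-u) * ((1 + c * h u) * Real.exp (c * ∫ r in u..L, h r)) with hF
  have hFk : ∀ u, F u = -Real.exp (-L) * (k u * Real.exp (∫ r in L..u, k r)) := by
    intro u
    have : Real.exp (-L) * Real.exp L = 1 := by rw [← Real.exp_add]; simp
    rw [hv]
    simp only [hF, hk]
    linear_combination (-(Real.exp (-u) * (1 + c * h u) * Real.exp (c * ∫ r in u..L, h r))) * this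
  have hF0 : ∀ u, 0 ≤ F u := fun u => by
    have : 0 ≤ 1 + c * h u := by nlinarith [(h01 u).1, (h01 u).2]
    simp only [hF]
    positivity
  have hFm : Measurable F := by
    have h1 : Measurable (fun u => ∫ r in u..L, h r) := by
      have : (fun u => ∫ r in u..L, h r) = fun u => -∫ r in L..u, h r :=
        funext fun u => intervalIntegral.integral_symm _ _
      rw [this]
      exact (intervalIntegral.continuous_primitive hint L).measurable.neg
    exact (Real.measurable_exp.comp measurable_neg).mul (((hh.const_mul c).const_add 1).mul
      (Real.measurable_exp.comp (h1.const_mul c)))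
  have hFint : ∀ T, ∫ u in x..T, F u = Real.exp (-x) * Real.exp (c * ∫ r in x..L, h r)
      - Real.exp (-T) * Real.exp (c * ∫ r in T..L, h r) := by
    intro T
    have : Real.exp (-L) * Real.exp L = 1 := by rw [← Real.exp_add]; simp
    simp_rw [hFk]
    rw [intervalIntegral.integral_const_mul, integral_mul_exp_primitive hkm hkK, hv, hv]
    linear_combination (Real.exp (-x) * Real.exp (c * ∫ r in x..L, h r)
      - Real.exp (-T) * Real.exp (c * ∫ r in T..L, h r)) * this
  have hlim : Tendsto (fun T => ∫ u in x..T, F u) atTop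
      (𝓝 (Real.exp (-x) * Real.exp (c * ∫ r in x..L, h r))) := by
    have h1 : Tendsto (fun T => Real.exp (-x) * Real.exp (c * ∫ r in x..L, h r) - Real.exp (-T))
        atTop (𝓝 (Real.exp (-x) * Real.exp (c * ∫ r in x..L, h r) - 0)) :=
      tendsto_const_nhds.sub (Real.tendsto_exp_atBot.comp tendsto_neg_atTop_atBot)
    rw [sub_zero] at h1
    refine h1.congr' ?_
    filter_upwards [eventually_ge_atTop L] with T hT
    rw [hFint, integral_tail_eq_zero hL hT, mul_zero, Real.exp_zero, mul_one]
  have hFii : ∀ T, IntervalIntegrable F volume x T := by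
    intro T
    have hbase : IntervalIntegrable (fun u => k u * Real.exp (∫ r in L..u, k r)) volume x T :=
      (intervalIntegrable_of_measurable_bounded hkm hkK x T).mul_continuousOn
        ((Real.continuous_exp.comp (intervalIntegral.continuous_primitive
          (fun a b => intervalIntegrable_of_measurable_bounded hkm hkK a b) L)).continuousOn)
    have := hbase.const_mul (-Real.exp (-L))
    exact this.congr_ae (Eventually.of_forall fun u => (hFk u).symm)
  have hFi : ∀ T, IntegrableOn F (Set.Ioc x T) volume := fun T => (hFii T).1
  have hnorm : ∀ u, ‖F u‖ = F u := fun u => Real.norm_of_nonneg (hF0 u)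
  have hIoi : IntegrableOn F (Set.Ioi x) volume :=
    integrableOn_Ioi_of_intervalIntegral_norm_tendsto _ x hFi tendsto_id (by simpa [hnorm] using hlim)
  rw [← ofReal_integral_eq_lintegral_ofReal hIoi (Eventually.of_forall hF0),
    tendsto_nhds_unique (intervalIntegral_tendsto_integral_Ioi x hIoi tendsto_id) hlim]

lemma lintegral_expMeasure_one {φ : ℝ → ℝ≥0∞} (hφ : Measurable φ) :
    ∫⁻ y, φ y ∂(expMeasure 1) = ∫⁻ y in Set.Ioi 0, ENNReal.ofReal (Real.exp (-y)) * φ y := by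
  have h1 : expMeasure 1 = volume.withDensity (exponentialPDF 1) := rfl
  have h2 : Measurable (exponentialPDF 1) := (measurable_exponentialPDFReal 1).ennreal_ofReal
  rw [h1, lintegral_withDensity_eq_lintegral_mul _ h2 hφ, ← lintegral_indicator measurableSet_Ioi]
  refine lintegral_congr_ae ?_
  filter_upwards [Measure.ae_ne volume (0 : ℝ)] with y hy
  rcases lt_or_gt_of_ne hy with h | h
  · simp [exponentialPDF_of_neg h, Set.indicator, h.not_gt]
  · simp [exponentialPDF_of_nonneg h.le, Set.indicator, h]

/-- The compensating factor is a fixed point of one renewal step: wait an exponential time, multiply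
by the mean weight of the point found there, and compensate from there on. This is the martingale
property in analytic form; `c` will be `exp θ - 1`, which exceeds `-1`. -/
lemma lintegral_expMeasure_tail (hh : Measurable h) (h01 : ∀ u, h u ∈ Set.Icc (0 : ℝ) 1)
    (hL : ∀ u, L < u → h u = 0) (hc : -1 ≤ c) (x : ℝ) :
    ∫⁻ y, ENNReal.ofReal (1 + c * h (x + y)) *
        ENNReal.ofReal (Real.exp (c * ∫ r in (x + y)..L, h r)) ∂(expMeasure 1)
      = ENNReal.ofReal (Real.exp (c * ∫ r in x..L, h r)) := by
  have hm : Measurable (fun u => ENNReal.ofReal (1 + c * h u) *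
      ENNReal.ofReal (Real.exp (c * ∫ r in u..L, h r))) := by
    have h1 : Measurable (fun u => ∫ r in u..L, h r) := by
      have : (fun u => ∫ r in u..L, h r) = fun u => -∫ r in L..u, h r :=
        funext fun u => intervalIntegral.integral_symm _ _
      rw [this]
      exact (intervalIntegral.continuous_primitive
        (intervalIntegrable_of_mem_Icc hh h01) L).measurable.neg
    exact ((hh.const_mul c).const_add 1).ennreal_ofReal.mul
      (Real.measurable_exp.comp (h1.const_mul c)).ennreal_ofReal
  have hx := lintegral_Ioi_exp_tail hh h01 hL hc x
  rw [ENNReal.ofReal_mul (Real.exp_nonneg _)] at hx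
  have hpos : ∀ u, 0 ≤ 1 + c * h u := fun u => by nlinarith [(h01 u).1, (h01 u).2]
  rw [lintegral_expMeasure_one (φ := fun y => ENNReal.ofReal (1 + c * h (x + y)) *
      ENNReal.ofReal (Real.exp (c * ∫ r in (x + y)..L, h r))) (hm.comp (measurable_const_add x)),
    ← lintegral_indicator measurableSet_Ioi]
  have e1 : ∀ u, ENNReal.ofReal (Real.exp x) * (Set.Ioi x).indicator (fun u => ENNReal.ofReal
        (Real.exp (-u) * ((1 + c * h u) * Real.exp (c * ∫ r in u..L, h r)))) u =
      (Set.Ioi 0).indicator (fun y => ENNReal.ofReal (Real.exp (-y)) *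
        (ENNReal.ofReal (1 + c * h (x + y)) *
          ENNReal.ofReal (Real.exp (c * ∫ r in (x + y)..L, h r)))) (u - x) := by
    intro u
    by_cases hu : x < u
    · rw [Set.indicator_of_mem (show u ∈ Set.Ioi x from hu),
        Set.indicator_of_mem (show u - x ∈ Set.Ioi 0 from sub_pos.2 hu), add_sub_cancel,
        ← ENNReal.ofReal_mul (Real.exp_nonneg _), ← ENNReal.ofReal_mul (hpos u),
        ← ENNReal.ofReal_mul (Real.exp_nonneg _), ← mul_assoc, ← Real.exp_add]
      congr 3
      ring
    · rw [Set.indicator_of_notMem (show u ∉ Set.Ioi x from hu),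
        Set.indicator_of_notMem (show u - x ∉ Set.Ioi 0 by simpa using hu), mul_zero]
  refine (lintegral_sub_right_eq_self (μ := (volume : Measure ℝ)) (fun y => (Set.Ioi 0).indicator
    (fun y => ENNReal.ofReal (Real.exp (-y)) * (ENNReal.ofReal (1 + c * h (x + y)) *
          ENNReal.ofReal (Real.exp (c * ∫ r in (x + y)..L, h r)))) y) x).symm.trans ?_
  simp_rw [← e1]
  rw [lintegral_const_mul' _ _ ENNReal.ofReal_ne_top, lintegral_indicator measurableSet_Ioi, hx,
    ← mul_assoc, ← ENNReal.ofReal_mul (Real.exp_nonneg _), ← Real.exp_add]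
  simp

end FixedPoint

/-! ### The exponential martingale of a marked Poisson process -/

section Thinning

variable {Ω : Type*} [MeasurableSpace Ω] {P : Measure Ω} {e z : ℕ → Ω → ℝ}

/-- The data of a standard Poisson process with standard exponential marks. -/
structure IsMarkedPoisson (P : Measure Ω) (e z : ℕ → Ω → ℝ) : Prop where
  measurable_e : ∀ k, Measurable (e k)
  measurable_z : ∀ k, Measurable (z k)
  map_e : ∀ k, P.map (e k) = expMeasure 1
  map_z : ∀ k, P.map (z k) = expMeasure 1
  iIndep : iIndepFun (Sum.elim e z) P

/-- The probability that a point at `u` is retained when the points with `(u, mark) ∈ R` are. -/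
noncomputable def retention (R : Set (ℝ × ℝ)) (u : ℝ) : ℝ := (expMeasure 1).real {ζ | (u, ζ) ∈ R}

/-- The weight `exp θ` of a retained point and `1` of another one. -/
noncomputable def markWeight (R : Set (ℝ × ℝ)) (θ : ℝ) (p : ℝ × ℝ) : ℝ≥0∞ :=
  ENNReal.ofReal (Real.exp (R.indicator (fun _ => θ) p))

/-- The number of retained points. -/
noncomputable def numRetained (R : Set (ℝ × ℝ)) (e z : ℕ → ℝ) : ℝ≥0∞ :=
  ∑' k : ℕ, R.indicator (fun _ => (1 : ℝ≥0∞)) (poissonJumpTime e k, z k)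

instance : IsProbabilityMeasure (expMeasure 1) := isProbabilityMeasure_expMeasure one_pos

variable {R : Set (ℝ × ℝ)} {L θ : ℝ}

lemma measurable_markWeight (hR : MeasurableSet R) : Measurable (markWeight R θ) :=
  (Real.measurable_exp.comp (measurable_const.indicator hR)).ennreal_ofReal

lemma measurable_retention (hR : MeasurableSet R) : Measurable (retention R) :=
  (measurable_measure_prodMk_left hR).ennreal_toReal

lemma retention_mem_Icc (u : ℝ) : retention R u ∈ Set.Icc (0 : ℝ) 1 :=
  ⟨measureReal_nonneg, measureReal_le_one⟩

lemma retention_eq_zero (hL : ∀ p ∈ R, p.1 ≤ L) {u : ℝ} (hu : L < u) : retention R u = 0 := by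
  have : {ζ | (u, ζ) ∈ R} = ∅ := by
    ext ζ
    simp only [Set.mem_ofPred_eq, Set.mem_empty_iff_false, iff_false]
    exact fun h => absurd (hL _ h) (not_le.2 hu)
  rw [retention, this, measureReal_empty]

lemma lintegral_markWeight (hR : MeasurableSet R) (u : ℝ) :
    ∫⁻ ζ, markWeight R θ (u, ζ) ∂(expMeasure 1)
      = ENNReal.ofReal (1 + (Real.exp θ - 1) * retention R u) := by
  have hS : MeasurableSet {ζ | (u, ζ) ∈ R} := measurable_prodMk_left hR
  have h1 : ∀ ζ, markWeight R θ (u, ζ) =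
      {ζ | (u, ζ) ∈ R}.indicator (fun _ => ENNReal.ofReal (Real.exp θ)) ζ +
      {ζ | (u, ζ) ∈ R}ᶜ.indicator (fun _ => 1) ζ := by
    intro ζ
    by_cases h : (u, ζ) ∈ R <;> simp [markWeight, h, Set.indicator]
  simp_rw [h1]
  rw [lintegral_add_left (measurable_const.indicator hS), lintegral_indicator_const hS,
    lintegral_indicator_const hS.compl, one_mul, ← ofReal_measureReal, ← ofReal_measureReal,
    probReal_compl_eq_one_sub hS, ← ENNReal.ofReal_mul (Real.exp_nonneg _),
    ← ENNReal.ofReal_add (mul_nonneg (Real.exp_nonneg _) measureReal_nonneg)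
      (sub_nonneg.2 measureReal_le_one)]
  congr 1
  simp only [retention]
  ring

/-- The compensating factor for the points after time `x`. -/
noncomputable def tailFactor (R : Set (ℝ × ℝ)) (L θ x : ℝ) : ℝ≥0∞ :=
  ENNReal.ofReal (Real.exp ((Real.exp θ - 1) * ∫ r in x..L, retention R r))

lemma measurable_tailFactor (hR : MeasurableSet R) : Measurable (tailFactor R L θ) := by
  have h1 : Measurable (fun u => ∫ r in u..L, retention R r) := by
    have : (fun u => ∫ r in u..L, retention R r) = fun u => -∫ r in L..u, retention R r :=
      funext fun u => intervalIntegral.integral_symm _ _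
    rw [this]
    exact (intervalIntegral.continuous_primitive
      (intervalIntegrable_of_mem_Icc (measurable_retention hR) retention_mem_Icc) L).measurable.neg
  exact (Real.measurable_exp.comp (h1.const_mul _)).ennreal_ofReal

lemma lintegral_tailFactor (hR : MeasurableSet R) (hL : ∀ p ∈ R, p.1 ≤ L) (x : ℝ) :
    ∫⁻ p : ℝ × ℝ, markWeight R θ (x + p.1, p.2) * tailFactor R L θ (x + p.1)
      ∂((expMeasure 1).prod (expMeasure 1)) = tailFactor R L θ x := by
  have hm : Measurable (fun p : ℝ × ℝ =>
      markWeight R θ (x + p.1, p.2) * tailFactor R L θ (x + p.1)) :=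
    ((measurable_markWeight hR).comp ((measurable_fst.const_add x).prodMk measurable_snd)).mul
      ((measurable_tailFactor hR).comp (measurable_fst.const_add x))
  rw [lintegral_prod _ hm.aemeasurable]
  have h1 : ∀ y, ∫⁻ ζ, markWeight R θ (x + y, ζ) * tailFactor R L θ (x + y) ∂(expMeasure 1)
      = ENNReal.ofReal (1 + (Real.exp θ - 1) * retention R (x + y)) * tailFactor R L θ (x + y) := by
    intro y
    rw [lintegral_mul_const' (tailFactor R L θ (x + y)) _ ENNReal.ofReal_ne_top,
      lintegral_markWeight hR]
  simp_rw [h1]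
  exact lintegral_expMeasure_tail (measurable_retention hR) retention_mem_Icc
    (fun u hu => retention_eq_zero hL hu) (by linarith [Real.exp_pos θ]) x

/-- The weight of the first `K` points, compensated for the later ones. -/
noncomputable def compensated (R : Set (ℝ × ℝ)) (L θ : ℝ) (e z : ℕ → ℝ) (K : ℕ) : ℝ≥0∞ :=
  (∏ k ∈ Finset.range K, markWeight R θ (poissonJumpTime e k, z k)) *
    tailFactor R L θ (∑ i ∈ Finset.range K, e i)

/-- The interarrival times and marks with index below `K` and those with index `K` form disjoint
blocks of an independent family. -/
lemma IsMarkedPoisson.indepFun_past (h : IsMarkedPoisson P e z) (K : ℕ) {β : Type*}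
    [MeasurableSpace β] {U : Ω → β}
    (hU : Measurable[⨆ i ∈ {i : ℕ ⊕ ℕ | Sum.elim id id i < K},
      MeasurableSpace.comap (Sum.elim e z i) inferInstance] U) :
    IndepFun U (fun ω => (e K ω, z K ω)) P := by
  have hle : ∀ i : ℕ ⊕ ℕ, MeasurableSpace.comap (Sum.elim e z i) inferInstance ≤ ‹MeasurableSpace Ω› := by
    rintro (i | i)
    · exact (h.measurable_e i).comap_le
    · exact (h.measurable_z i).comap_le
  have hind := indep_iSup_of_disjoint (S := {i : ℕ ⊕ ℕ | Sum.elim id id i < K})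
    (T := {i : ℕ ⊕ ℕ | Sum.elim id id i = K}) hle h.iIndep
    (Set.disjoint_left.2 fun i (hi : _ < K) (hi' : _ = K) => absurd hi' hi.ne)
  rw [IndepFun_iff_Indep]
  refine indep_of_indep_of_le_left (indep_of_indep_of_le_right hind ?_) hU.comap_le
  rw [← measurable_iff_comap_le]
  have hmeas : ∀ i : ℕ ⊕ ℕ, Sum.elim id id i = K →
      Measurable[⨆ i ∈ {i : ℕ ⊕ ℕ | Sum.elim id id i = K},
        MeasurableSpace.comap (Sum.elim e z i) inferInstance] (Sum.elim e z i) := fun i hi =>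
    measurable_iff_comap_le.2 (le_iSup₂_of_le i hi le_rfl)
  exact (hmeas (Sum.inl K) rfl).prodMk (hmeas (Sum.inr K) rfl)

lemma measurable_numRetained (hR : MeasurableSet R) (he : ∀ k, Measurable (e k))
    (hz : ∀ k, Measurable (z k)) :
    Measurable (fun ω => numRetained R (fun k => e k ω) (fun k => z k ω)) := by
  refine Measurable.tsum fun k => ?_
  exact (measurable_const.indicator hR).comp
    ((Finset.measurable_fun_sum _ fun i _ => he i).prodMk (hz k))

lemma IsMarkedPoisson.ae_nonneg (h : IsMarkedPoisson P e z) :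
    ∀ᵐ ω ∂P, ∀ k, 0 < e k ω ∧ 0 < z k ω := by
  have hpos : ∀ᵐ x ∂(expMeasure 1), 0 < x := by
    have h1 : (expMeasure 1) (Set.Iic 0) = 0 := by
      have h2 : expMeasure 1 = volume.withDensity (exponentialPDF 1) := rfl
      rw [h2, withDensity_apply _ measurableSet_Iic]
      have h3 : volume.restrict (Set.Iic (0 : ℝ)) = volume.restrict (Set.Iio 0) :=
        Measure.restrict_congr_set Iio_ae_eq_Iic.symm
      rw [h3]
      exact lintegral_exponentialPDF_of_nonpos le_rfl
    rw [ae_iff]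
    convert h1 using 2
    ext x; simp
  refine ae_all_iff.2 fun k => ?_
  have he := (h.map_e k).symm ▸ hpos
  have hz := (h.map_z k).symm ▸ hpos
  filter_upwards [ae_of_ae_map (h.measurable_e k).aemeasurable he,
    ae_of_ae_map (h.measurable_z k).aemeasurable hz] with ω h1 h2
  exact ⟨h1, h2⟩

/-- Interarrival times are almost surely unbounded. -/
lemma IsMarkedPoisson.ae_exists_gt (h : IsMarkedPoisson P e z) :
    ∀ᵐ ω ∂P, ∀ l : ℝ, ∃ k, l < e k ω := by
  have hnat : ∀ l : ℕ, P {ω | ∀ k, e k ω ≤ l} = 0 := by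
    intro l
    set q : ℝ≥0∞ := expMeasure 1 (Set.Iic (l : ℝ)) with hq
    have hq1 : q < 1 := by
      have h1 := cdf_expMeasure_eq one_pos (l : ℝ)
      rw [cdf_eq_real, if_pos (Nat.cast_nonneg l), one_mul] at h1
      rw [hq, ← ofReal_measureReal, h1, ← ENNReal.ofReal_one]
      exact (ENNReal.ofReal_lt_ofReal_iff one_pos).2 (by linarith [Real.exp_pos (-(l : ℝ))])
    have hbound : ∀ K : ℕ, P {ω | ∀ k, e k ω ≤ l} ≤ q ^ K := by
      intro K
      have hie : iIndepFun e P := h.iIndep.precomp (g := Sum.inl) Sum.inl_injective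
      have h2 := hie.measure_inter_preimage_eq_mul (Finset.range K)
        (sets := fun _ => Set.Iic (l : ℝ)) fun i _ => measurableSet_Iic
      have h3 : ∀ i, P (e i ⁻¹' Set.Iic (l : ℝ)) = q := fun i => by
        rw [← Measure.map_apply (h.measurable_e i) measurableSet_Iic, h.map_e]
      simp only [h3, Finset.prod_const, Finset.card_range] at h2
      rw [← h2]
      exact measure_mono fun ω hω => Set.mem_iInter₂.2 fun i _ => hω i
    exact le_antisymm (ge_of_tendsto' (ENNReal.tendsto_pow_atTop_nhds_zero_of_lt_one hq1) hbound)
      bot_le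
  have hall : ∀ᵐ ω ∂P, ∀ l : ℕ, ¬ ∀ k, e k ω ≤ l := ae_all_iff.2 fun l => by
    rw [ae_iff]; simpa using hnat l
  filter_upwards [hall] with ω hω l
  obtain ⟨n, hn⟩ := exists_nat_ge l
  have := hω n
  push Not at this
  obtain ⟨k, hk⟩ := this
  exact ⟨k, hn.trans_lt hk⟩

variable [IsProbabilityMeasure P]

lemma IsMarkedPoisson.map_pair (h : IsMarkedPoisson P e z) (K : ℕ) :
    P.map (fun ω => (e K ω, z K ω)) = (expMeasure 1).prod (expMeasure 1) := by
  have hind : IndepFun (e K) (z K) P :=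
    h.iIndep.indepFun (i := Sum.inl K) (j := Sum.inr K) (by simp)
  rw [(indepFun_iff_map_prod_eq_prod_map_map (h.measurable_e K).aemeasurable
    (h.measurable_z K).aemeasurable).1 hind, h.map_e, h.map_z]

lemma IsMarkedPoisson.lintegral_compensated_succ (h : IsMarkedPoisson P e z)
    (hR : MeasurableSet R) (hL : ∀ p ∈ R, p.1 ≤ L) (K : ℕ) :
    ∫⁻ ω, compensated R L θ (fun k => e k ω) (fun k => z k ω) (K + 1) ∂P
      = ∫⁻ ω, compensated R L θ (fun k => e k ω) (fun k => z k ω) K ∂P := by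
  let S : Ω → ℝ := fun ω => ∑ i ∈ Finset.range K, e i ω
  let W : Ω → ℝ≥0∞ := fun ω =>
    ∏ k ∈ Finset.range K, markWeight R θ (poissonJumpTime (fun k => e k ω) k, z k ω)
  -- Stated for an arbitrary σ-algebra because it is used twice: for the ambient one, and for the
  -- one generated by the first `K` points.
  have key : ∀ m : MeasurableSpace Ω, (∀ k < K, Measurable[m] (e k)) →
      (∀ k < K, Measurable[m] (z k)) → Measurable[m] (fun ω => (W ω, S ω)) := by
    intro m he hz
    have hS : ∀ j ≤ K, Measurable[m] (fun ω => ∑ i ∈ Finset.range j, e i ω) := fun j hj =>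
      Finset.measurable_fun_sum _ fun i hi => he i ((Finset.mem_range.1 hi).trans_le hj)
    refine Measurable.prodMk (Finset.measurable_fun_prod _ fun k hk => ?_) (hS K le_rfl)
    have hk' := Finset.mem_range.1 hk
    exact (measurable_markWeight hR).comp ((hS (k + 1) hk').prodMk (hz k hk'))
  have hUm : Measurable (fun ω => (W ω, S ω)) :=
    key _ (fun k _ => h.measurable_e k) fun k _ => h.measurable_z k
  have hYm : Measurable (fun ω => (e K ω, z K ω)) := (h.measurable_e K).prodMk (h.measurable_z K)
  have hind : IndepFun (fun ω => (W ω, S ω)) (fun ω => (e K ω, z K ω)) P := by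
    refine h.indepFun_past K (key _ (fun k hk => ?_) fun k hk => ?_)
    · exact measurable_iff_comap_le.2 (le_iSup₂_of_le (Sum.inl k) hk le_rfl)
    · exact measurable_iff_comap_le.2 (le_iSup₂_of_le (Sum.inr k) hk le_rfl)
  have hlaw := (indepFun_iff_map_prod_eq_prod_map_map hUm.aemeasurable hYm.aemeasurable).1 hind
  rw [h.map_pair K] at hlaw
  let G : (ℝ≥0∞ × ℝ) × (ℝ × ℝ) → ℝ≥0∞ := fun q =>
    q.1.1 * (markWeight R θ (q.1.2 + q.2.1, q.2.2) * tailFactor R L θ (q.1.2 + q.2.1))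
  have hadd : Measurable (fun q : (ℝ≥0∞ × ℝ) × (ℝ × ℝ) => q.1.2 + q.2.1) :=
    (measurable_snd.comp measurable_fst).add (measurable_fst.comp measurable_snd)
  have hG : Measurable G := (measurable_fst.comp measurable_fst).mul
    (((measurable_markWeight hR).comp (hadd.prodMk (measurable_snd.comp measurable_snd))).mul
      ((measurable_tailFactor hR).comp hadd))
  have e1 : ∀ ω, compensated R L θ (fun k => e k ω) (fun k => z k ω) (K + 1)
      = G ((W ω, S ω), (e K ω, z K ω)) := by
    intro ω
    simp only [compensated, G, W, S, Finset.prod_range_succ, Finset.sum_range_succ,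
      poissonJumpTime]
    rw [mul_assoc]
  have e2 : ∀ ω, compensated R L θ (fun k => e k ω) (fun k => z k ω) K
      = W ω * tailFactor R L θ (S ω) := fun ω => rfl
  have hG2 : Measurable (fun q : ℝ≥0∞ × ℝ => q.1 * tailFactor R L θ q.2) :=
    measurable_fst.mul ((measurable_tailFactor hR).comp measurable_snd)
  simp_rw [e1, e2]
  rw [← lintegral_map (f := G) (g := fun ω => ((W ω, S ω), (e K ω, z K ω))) hG (hUm.prodMk hYm),
    hlaw, lintegral_prod _ hG.aemeasurable,
    ← lintegral_map (f := fun q : ℝ≥0∞ × ℝ => q.1 * tailFactor R L θ q.2)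
      (g := fun ω => (W ω, S ω)) hG2 hUm]
  refine lintegral_congr fun q => ?_
  have hm : Measurable (fun p : ℝ × ℝ =>
      markWeight R θ (q.2 + p.1, p.2) * tailFactor R L θ (q.2 + p.1)) :=
    ((measurable_markWeight hR).comp ((measurable_fst.const_add _).prodMk measurable_snd)).mul
      ((measurable_tailFactor hR).comp (measurable_fst.const_add _))
  simp only [G]
  rw [lintegral_const_mul _ hm, lintegral_tailFactor hR hL]

lemma IsMarkedPoisson.lintegral_compensated (h : IsMarkedPoisson P e z)
    (hR : MeasurableSet R) (hL : ∀ p ∈ R, p.1 ≤ L) (K : ℕ) :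
    ∫⁻ ω, compensated R L θ (fun k => e k ω) (fun k => z k ω) K ∂P = tailFactor R L θ 0 := by
  induction K with
  | zero => simp [compensated]
  | succ K ih => rw [h.lintegral_compensated_succ hR hL, ih]

/-- For almost every realization only finitely many points are retained. -/
lemma exists_numRetained_eq (hL : ∀ p ∈ R, p.1 ≤ L) {e z : ℕ → ℝ} (he : ∀ k, 0 < e k)
    (hgt : ∃ k, L < e k) : ∃ K₀, (∀ K ≥ K₀, L < ∑ i ∈ Finset.range K, e i) ∧
      ∀ K ≥ K₀, numRetained R e z =
        ∑ k ∈ Finset.range K, R.indicator (fun _ => (1 : ℝ≥0∞)) (poissonJumpTime e k, z k) := by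
  obtain ⟨k₀, hk₀⟩ := hgt
  have hsum : ∀ K ≥ k₀ + 1, L < ∑ i ∈ Finset.range K, e i := fun K hK =>
    hk₀.trans_le (Finset.single_le_sum (fun i _ => (he i).le) (Finset.mem_range.2 hK))
  refine ⟨k₀ + 1, hsum, fun K hK => ?_⟩
  refine tsum_eq_sum fun k hk => Set.indicator_of_notMem (fun hmem => ?_) _
  have h1 := hL _ hmem
  have h2 := hsum (k + 1) (by have := Finset.mem_range.not.1 hk; omega)
  exact absurd h1 (not_le.2 h2)

lemma prod_markWeight_eq (e z : ℕ → ℝ) (K : ℕ) :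
    ∏ k ∈ Finset.range K, markWeight R θ (poissonJumpTime e k, z k) =
      ENNReal.ofReal (Real.exp (θ * (∑ k ∈ Finset.range K,
        R.indicator (fun _ => (1 : ℝ≥0∞)) (poissonJumpTime e k, z k)).toReal)) := by
  rw [ENNReal.toReal_sum fun k _ => ?_, Finset.mul_sum, Real.exp_sum, ENNReal.ofReal_prod_of_nonneg
    fun _ _ => Real.exp_nonneg _]
  · refine Finset.prod_congr rfl fun k _ => ?_
    by_cases h : (poissonJumpTime e k, z k) ∈ R <;> simp [markWeight, h]
  · by_cases h : (poissonJumpTime e k, z k) ∈ R <;> simp [h]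

lemma tailFactor_eq_one (hL : ∀ p ∈ R, p.1 ≤ L) {x : ℝ} (hx : L ≤ x) : tailFactor R L θ x = 1 := by
  rw [tailFactor, integral_tail_eq_zero (fun u hu => retention_eq_zero hL hu) hx]
  simp

/-- The bound is uniform in `x ≥ 0`, as needed for dominated convergence in the number of points. -/
lemma tailFactor_le (hR : MeasurableSet R) (hL : ∀ p ∈ R, p.1 ≤ L) (hL0 : 0 ≤ L) {x : ℝ}
    (hx : 0 ≤ x) : tailFactor R L θ x ≤
      ENNReal.ofReal (Real.exp (|Real.exp θ - 1| * ∫ r in (0 : ℝ)..L, retention R r)) := by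
  have h1 := integral_tail_mem_Icc (measurable_retention hR) retention_mem_Icc
    (fun u hu => retention_eq_zero hL hu) hL0 hx
  refine ENNReal.ofReal_le_ofReal (Real.exp_le_exp.2 ?_)
  exact mul_le_mul (le_abs_self _) h1.2 h1.1 (abs_nonneg _)

/-- The exponential moments of the number of retained points. -/
lemma IsMarkedPoisson.lintegral_exp_numRetained (h : IsMarkedPoisson P e z) (hR : MeasurableSet R)
    (hL : ∀ p ∈ R, p.1 ≤ L) (hL0 : 0 ≤ L) (θ : ℝ) :
    ∫⁻ ω, ENNReal.ofReal (Real.exp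
        (θ * (numRetained R (fun k => e k ω) (fun k => z k ω)).toReal)) ∂P
      = tailFactor R L θ 0 := by
  have hcomp : ∀ K, Measurable
      (fun ω => compensated R L θ (fun k => e k ω) (fun k => z k ω) K) := fun K =>
    (Finset.measurable_fun_prod _ fun k _ => (measurable_markWeight hR).comp
      ((Finset.measurable_fun_sum _ fun i _ => h.measurable_e i).prodMk (h.measurable_z k))).mul
      ((measurable_tailFactor hR).comp (Finset.measurable_fun_sum _ fun i _ => h.measurable_e i))
  have hlim : ∀ᵐ ω ∂P, Tendsto (fun K => compensated R L θ (fun k => e k ω) (fun k => z k ω) K)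
      atTop (𝓝 (ENNReal.ofReal (Real.exp
        (θ * (numRetained R (fun k => e k ω) (fun k => z k ω)).toReal)))) := by
    filter_upwards [h.ae_nonneg, h.ae_exists_gt] with ω hpos hgt
    obtain ⟨K₀, hK₀, hN⟩ := exists_numRetained_eq (z := fun k => z k ω) hL
      (fun k => (hpos k).1) (hgt L)
    refine tendsto_const_nhds.congr' ?_
    filter_upwards [eventually_ge_atTop K₀] with K hK
    rw [compensated, tailFactor_eq_one hL (hK₀ K hK).le, mul_one, prod_markWeight_eq, hN K hK]
  -- Fatou's lemma comes first because it gives finiteness of the exponential moment, which then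
  -- serves in the dominating function. Domination upgrades the inequality to equality.
  have hfatou : ∫⁻ ω, ENNReal.ofReal (Real.exp
        (θ * (numRetained R (fun k => e k ω) (fun k => z k ω)).toReal)) ∂P
      ≤ tailFactor R L θ 0 := by
    calc _ = ∫⁻ ω, liminf (fun K => compensated R L θ (fun k => e k ω) (fun k => z k ω) K) atTop ∂P :=
          lintegral_congr_ae (hlim.mono fun ω hω => hω.liminf_eq.symm)
      _ ≤ liminf (fun K => ∫⁻ ω, compensated R L θ (fun k => e k ω) (fun k => z k ω) K ∂P) atTop :=
          lintegral_liminf_le hcomp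
      _ = _ := by simp_rw [h.lintegral_compensated hR hL]; simp
  set B : ℝ≥0∞ :=
    ENNReal.ofReal (Real.exp (|Real.exp θ - 1| * ∫ r in (0 : ℝ)..L, retention R r)) with hB
  have hdom := tendsto_lintegral_of_dominated_convergence (μ := P)
    (F := fun K ω => compensated R L θ (fun k => e k ω) (fun k => z k ω) K)
    (fun ω => (1 + ENNReal.ofReal (Real.exp
        (θ * (numRetained R (fun k => e k ω) (fun k => z k ω)).toReal))) * B)
    hcomp (fun K => ?_) ?_ hlim
  · simp_rw [h.lintegral_compensated hR hL] at hdom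
    exact tendsto_nhds_unique hdom tendsto_const_nhds
  · filter_upwards [h.ae_nonneg, h.ae_exists_gt] with ω hpos hgt
    obtain ⟨K₀, hK₀, hN⟩ := exists_numRetained_eq (z := fun k => z k ω) hL
      (fun k => (hpos k).1) (hgt L)
    rw [compensated]
    refine mul_le_mul' ?_ (tailFactor_le hR hL hL0
      (Finset.sum_nonneg fun i _ => (hpos i).1.le))
    rw [prod_markWeight_eq]
    rcases le_total θ 0 with hθ | hθ
    · refine le_add_right ?_
      rw [← ENNReal.ofReal_one]
      exact ENNReal.ofReal_le_ofReal (Real.exp_le_one_iff.2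
        (mul_nonpos_of_nonpos_of_nonneg hθ ENNReal.toReal_nonneg))
    · refine le_add_left (ENNReal.ofReal_le_ofReal (Real.exp_le_exp.2
        (mul_le_mul_of_nonneg_left (ENNReal.toReal_mono ?_ (ENNReal.sum_le_tsum _)) hθ)))
      rw [hN K₀ le_rfl]
      refine ENNReal.sum_ne_top.2 fun k _ => ?_
      by_cases hk : (poissonJumpTime (fun k => e k ω) k, z k ω) ∈ R <;> simp [hk]
  · rw [lintegral_mul_const' _ _ ENNReal.ofReal_ne_top]
    refine ENNReal.mul_ne_top ?_ ENNReal.ofReal_ne_top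
    rw [lintegral_add_left measurable_const]
    simpa using (hfatou.trans_lt ENNReal.ofReal_lt_top).ne

/-- The number of retained points has a Poisson distribution. -/
theorem IsMarkedPoisson.map_numRetained (h : IsMarkedPoisson P e z) (hR : MeasurableSet R)
    (hL : ∀ p ∈ R, p.1 ≤ L) (hL0 : 0 ≤ L) :
    P.map (fun ω => (numRetained R (fun k => e k ω) (fun k => z k ω)).toReal) =
      (poissonMeasure (∫ r in (0 : ℝ)..L, retention R r).toNNReal).map (fun k : ℕ => (k : ℝ)) := by
  set X : Ω → ℝ := fun ω => (numRetained R (fun k => e k ω) (fun k => z k ω)).toReal with hX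
  set r := (∫ r in (0 : ℝ)..L, retention R r).toNNReal with hr
  have hr' : (r : ℝ) = ∫ r in (0 : ℝ)..L, retention R r :=
    Real.coe_toNNReal _ (intervalIntegral.integral_nonneg hL0 fun u _ => (retention_mem_Icc u).1)
  have hXm : Measurable X := (measurable_numRetained hR h.measurable_e h.measurable_z).ennreal_toReal
  have hlint := h.lintegral_exp_numRetained hR hL hL0
  have hint : ∀ θ, Integrable (fun ω => Real.exp (θ * X ω)) P := fun θ => by
    refine ⟨(Real.measurable_exp.comp (hXm.const_mul θ)).aestronglyMeasurable, ?_⟩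
    rw [hasFiniteIntegral_iff_ofReal (Eventually.of_forall fun ω => Real.exp_nonneg _), hlint θ]
    exact ENNReal.ofReal_lt_top
  have hmgf : mgf X P = mgf (fun k : ℕ => (k : ℝ)) (poissonMeasure r) := by
    funext θ
    rw [mgf_poisson, mgf, integral_eq_lintegral_of_nonneg_ae
      (Eventually.of_forall fun ω => Real.exp_nonneg _) (hint θ).aestronglyMeasurable, hlint θ,
      tailFactor, ENNReal.toReal_ofReal (Real.exp_nonneg _), hr', mul_comm]
  -- All exponential moments are finite, so equality of the real moment generating functions extends
  -- to the complex ones on the whole plane, and these determine the law.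
  have hset : integrableExpSet X P = Set.univ := Set.eq_univ_of_forall hint
  refine Measure.ext_of_complexMGF_eq hXm.aemeasurable (by fun_prop) (funext fun w => ?_)
  exact eqOn_complexMGF_of_mgf hmgf (by simp [hset])

end Thinning

/-! ### The number of jobs for a fixed path of the background process -/

section FixedPath

variable {E : Type*}

/-- The time at which the cumulative arrival rate reaches the level `u`. -/
noncomputable def hitTime (lam : E → ℝ≥0) (f : ℝ≥0 → E) (u : ℝ) : ℝ≥0∞ :=
  ⨅ (s : ℝ≥0) (_ : u ≤ cumRate lam f s), (s : ℝ≥0∞)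

/-- The pairs of a point of the standard Poisson process and of a standard exponential requirement
for which the corresponding job is in the system at time `t`. -/
def systemSet (lam kap mu : E → ℝ≥0) (f : ℝ≥0 → E) (t : ℝ≥0) : Set (ℝ × ℝ) :=
  {p | hitTime lam f p.1 ≤ t ∧ ¬ serviceRequirement kap (f (hitTime lam f p.1).toNNReal) p.2
    ≤ workDone mu f (hitTime lam f p.1).toNNReal t}

/-- For a fixed path, whether job `k` is present depends only on the `k`-th Poisson point and its
own requirement. -/
lemma numJobs_eq_numRetained (lam kap mu : E → ℝ≥0) (f : ℝ≥0 → E) (e z : ℕ → ℝ) (t : ℝ≥0) :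
    numJobs lam kap mu f e z t = numRetained (systemSet lam kap mu f t) e z := by
  classical
  refine tsum_congr fun k => ?_
  rw [Set.indicator_apply]
  congr!

lemma real_not_serviceRequirement_le (kap : E → ℝ≥0) (x : E) {w : ℝ} (hw : 0 ≤ w) :
    (expMeasure 1).real {ζ | ¬ serviceRequirement kap x ζ ≤ ENNReal.ofReal w}
      = Real.exp (-((kap x : ℝ) * w)) := by
  by_cases hx : kap x = 0
  · simp [serviceRequirement, hx]
  · have hk : 0 < (kap x : ℝ) := NNReal.coe_pos.2 (pos_iff_ne_zero.2 hx)
    have hset : {ζ | ¬ serviceRequirement kap x ζ ≤ ENNReal.ofReal w}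
        = (Set.Iic ((kap x : ℝ) * w))ᶜ := by
      ext ζ
      simp only [serviceRequirement, hx, if_false, Set.mem_ofPred_eq, not_le, Set.mem_compl_iff,
        Set.mem_Iic]
      rw [ENNReal.ofReal_lt_ofReal_iff_of_nonneg hw, lt_div_iff₀ hk, mul_comm]
    rw [hset, probReal_compl_eq_one_sub measurableSet_Iic, ← cdf_eq_real,
      cdf_expMeasure_eq one_pos, if_pos (by positivity)]
    simp

lemma phi_const_mul (c : ℝ≥0) (lam kap mu : E → ℝ≥0) (t : ℝ≥0) (f : ℝ≥0 → E) :
    phi (fun x => c * lam x) kap mu t f = c * phi lam kap mu t f := by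
  rw [phi, phi, ← intervalIntegral.integral_const_mul]
  refine intervalIntegral.integral_congr fun s _ => ?_
  push_cast
  ring

variable [Finite E] [MetricSpace E] [MeasurableSpace E] [BorelSpace E] {f : ℝ≥0 → E}

lemma continuous_cumRate (hf : Measurable f) (lam : E → ℝ≥0) : Continuous (cumRate lam f) :=
  (continuous_integral_comp_path hf lam 0).comp NNReal.continuous_coe

lemma monotone_cumRate (hf : Measurable f) (lam : E → ℝ≥0) : Monotone (cumRate lam f) := by
  intro a b hab
  exact intervalIntegral.integral_mono_interval le_rfl a.coe_nonneg (by exact_mod_cast hab)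
    (Eventually.of_forall fun r => NNReal.coe_nonneg _) (intervalIntegrable_comp_path hf lam _ _)

/-- The cumulative rate is continuous and monotone, so the infimum is attained when finite. This
duality carries both the measurability of hitting times and the change of variables. -/
lemma hitTime_le_iff (hf : Measurable f) (lam : E → ℝ≥0) (u : ℝ) (s : ℝ≥0) :
    hitTime lam f u ≤ s ↔ u ≤ cumRate lam f s := by
  refine ⟨fun h => ?_, fun h => iInf₂_le s h⟩
  by_contra hcon
  push Not at hcon
  -- Some `r > s` still has cumulative rate below `u`. By monotonicity, every time at which `u` has
  -- been reached is at least `r`, so the hitting time exceeds `s`.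
  have h1 : ∀ᶠ r in 𝓝[>] s, cumRate lam f r < u :=
    ((continuous_cumRate hf lam).tendsto s |>.eventually (gt_mem_nhds hcon)).filter_mono
      nhdsWithin_le_nhds
  obtain ⟨r, hr, hsr⟩ := (h1.and self_mem_nhdsWithin).exists
  have h2 : (r : ℝ≥0∞) ≤ hitTime lam f u := by
    refine le_iInf₂ fun q hq => ?_
    by_contra hlt
    push Not at hlt
    have := monotone_cumRate hf lam (ENNReal.coe_le_coe.1 hlt.le)
    linarith
  have h3 : (s : ℝ≥0∞) < r := ENNReal.coe_lt_coe.2 hsr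
  exact absurd (h3.trans_le (h2.trans h)) (lt_irrefl _)

/-! ### Joint measurability in the background path -/

section PathFamily

variable {Ω : Type*} [MeasurableSpace Ω] {J : ℝ≥0 → Ω → E}

lemma IsBackgroundProcess.measurable_cumRate (hJ : IsBackgroundProcess J) (lam : E → ℝ≥0)
    (s : ℝ≥0) : Measurable (fun ω => cumRate lam (fun s => J s ω) s) :=
  measurable_interval_integral (hJ.measurable_comp lam) measurable_const measurable_const

lemma IsBackgroundProcess.measurable_hitTime (hJ : IsBackgroundProcess J) (lam : E → ℝ≥0) :
    Measurable (fun p : Ω × ℝ => hitTime lam (fun s => J s p.1) p.2) := by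
  refine measurable_of_Iic fun a => ?_
  induction a with
  | top => simp
  | coe s =>
    have : (fun p : Ω × ℝ => hitTime lam (fun s => J s p.1) p.2) ⁻¹' Set.Iic (s : ℝ≥0∞)
        = {p | p.2 ≤ cumRate lam (fun s => J s p.1) s} := by
      ext p
      exact hitTime_le_iff (hJ.cadlag p.1).measurable lam p.2 s
    rw [this]
    exact measurableSet_le measurable_snd ((hJ.measurable_cumRate lam s).comp measurable_fst)

lemma measurable_serviceRequirement (kap : E → ℝ≥0) :
    Measurable (fun p : E × ℝ => serviceRequirement kap p.1 p.2) := by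
  refine measurable_from_prod_countable_right fun x => ?_
  by_cases hx : kap x = 0
  · simp only [serviceRequirement, hx, if_true]
    exact measurable_const
  · simp only [serviceRequirement, hx, if_false]
    exact (measurable_id.div_const _).ennreal_ofReal

lemma IsBackgroundProcess.measurableSet_systemSet (hJ : IsBackgroundProcess J)
    (lam kap mu : E → ℝ≥0) (t : ℝ≥0) :
    MeasurableSet {p : Ω × (ℝ × ℝ) | p.2 ∈ systemSet lam kap mu (fun s => J s p.1) t} := by
  have hhit : Measurable (fun p : Ω × (ℝ × ℝ) => hitTime lam (fun s => J s p.1) p.2.1) :=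
    (hJ.measurable_hitTime lam).comp
      (measurable_fst.prodMk (measurable_fst.comp measurable_snd))
  have hJhit : Measurable (fun p : Ω × (ℝ × ℝ) =>
      J (hitTime lam (fun s => J s p.1) p.2.1).toNNReal p.1) :=
    hJ.measurable_uncurry.comp (hhit.ennreal_toNNReal.prodMk measurable_fst)
  have hsr : Measurable (fun p : Ω × (ℝ × ℝ) => serviceRequirement kap
      (J (hitTime lam (fun s => J s p.1) p.2.1).toNNReal p.1) p.2.2) :=
    (measurable_serviceRequirement kap).comp
      (hJhit.prodMk (measurable_snd.comp measurable_snd))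
  have hwd : Measurable (fun p : Ω × (ℝ × ℝ) => workDone mu (fun s => J s p.1)
      (hitTime lam (fun s => J s p.1) p.2.1).toNNReal t) := by
    refine Measurable.ennreal_ofReal ?_
    refine measurable_interval_integral (Ω := Ω × (ℝ × ℝ))
      (g := fun p r => (mu (J r.toNNReal p.1) : ℝ)) ?_ hhit.ennreal_toNNReal.coe_nnreal_real
      measurable_const
    exact (hJ.measurable_comp mu).comp
      ((measurable_fst.comp measurable_fst).prodMk measurable_snd)
  exact (measurableSet_le hhit (measurable_const (a := (t : ℝ≥0∞)))).inter
    (measurableSet_le hsr hwd).compl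

lemma IsBackgroundProcess.measurable_numJobs (hJ : IsBackgroundProcess J)
    (lam kap mu : E → ℝ≥0) (t : ℝ≥0) :
    Measurable (fun p : Ω × (ℕ ⊕ ℕ → ℝ) => numJobs lam kap mu (fun s => J s p.1)
      (fun k => p.2 (Sum.inl k)) (fun k => p.2 (Sum.inr k)) t) := by
  simp only [numJobs_eq_numRetained, numRetained]
  refine Measurable.tsum fun k => ?_
  have hS := hJ.measurableSet_systemSet lam kap mu t
  have hm : Measurable (fun p : Ω × (ℕ ⊕ ℕ → ℝ) =>
      (p.1, (poissonJumpTime (fun k => p.2 (Sum.inl k)) k, p.2 (Sum.inr k)))) := by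
    refine measurable_fst.prodMk (Measurable.prodMk ?_ ?_)
    · exact Finset.measurable_fun_sum _ fun i _ => (measurable_pi_apply _).comp measurable_snd
    · exact (measurable_pi_apply _).comp measurable_snd
  classical
  simp only [Set.indicator_apply]
  exact Measurable.ite (hm hS) measurable_const measurable_const

end PathFamily

lemma IsCadlag.measurableSet_systemSet (hf : IsCadlag f) (lam kap mu : E → ℝ≥0) (t : ℝ≥0) :
    MeasurableSet (systemSet lam kap mu f t) := by
  have h := (isBackgroundProcess_const hf).measurableSet_systemSet lam kap mu t
  exact measurable_prodMk_left (x := ()) h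

lemma le_of_mem_systemSet (hf : Measurable f) (lam kap mu : E → ℝ≥0) (t : ℝ≥0) :
    ∀ p ∈ systemSet lam kap mu f t, p.1 ≤ cumRate lam f t :=
  fun p hp => (hitTime_le_iff hf lam p.1 t).1 hp.1

lemma retention_systemSet (hf : Measurable f) (lam kap mu : E → ℝ≥0) (t : ℝ≥0) {u : ℝ}
    (hu : u ≤ cumRate lam f t) :
    retention (systemSet lam kap mu f t) u =
      Real.exp (-((kap (f (hitTime lam f u).toNNReal) : ℝ) *
        ∫ r in ((hitTime lam f u).toNNReal : ℝ)..t, (mu (f r.toNNReal) : ℝ))) := by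
  have hle := (hitTime_le_iff hf lam u t).2 hu
  have hle' : (hitTime lam f u).toNNReal ≤ t := by
    simpa using ENNReal.toNNReal_mono ENNReal.coe_ne_top hle
  rw [← real_not_serviceRequirement_le kap _
    (integral_comp_path_nonneg f mu (by exact_mod_cast hle'))]
  simp only [retention, systemSet, Set.mem_ofPred_eq, hle, true_and]
  rfl

/-- The passage time at a uniform level is distributed according to the arrival rate. -/
lemma map_hitTime (hf : Measurable f) (hfit : Measurable (hitTime lam f)) (t : ℝ≥0) :
    Measure.map (fun u => ((hitTime lam f u).toNNReal : ℝ))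
      (volume.restrict (Set.Ioc 0 (cumRate lam f t)))
      = (volume.restrict (Set.Ioc (0 : ℝ) t)).withDensity
        (fun s => (lam (f s.toNNReal) : ℝ≥0∞)) := by
  have hm : Measurable (fun u => ((hitTime lam f u).toNNReal : ℝ)) :=
    hfit.ennreal_toNNReal.coe_nnreal_real
  have hlint : ∀ s : ℝ≥0, ∫⁻ r in Set.Ioc (0 : ℝ) s, (lam (f r.toNNReal) : ℝ≥0∞)
      = ENNReal.ofReal (cumRate lam f s) := by
    intro s
    rw [cumRate, intervalIntegral.integral_of_le s.coe_nonneg, ofReal_integral_eq_lintegral_ofReal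
      (intervalIntegrable_comp_path hf lam 0 s).1
      (Eventually.of_forall fun r => NNReal.coe_nonneg _)]
    simp
  have hcum0 : ∀ s, 0 ≤ cumRate lam f s := fun s => integral_comp_path_nonneg f lam s.coe_nonneg
  -- For `a ≥ 0`, the levels `u ∈ (0, Λ(t)]` reached by time `a` form `(0, Λ(min a t)]`, whose
  -- length is the integral of `λ` over `(0, min a t]`.
  refine Measure.ext_of_Iic _ _ fun a => ?_
  rw [Measure.map_apply hm measurableSet_Iic, withDensity_apply _ measurableSet_Iic,
    Measure.restrict_restrict measurableSet_Iic,
    Measure.restrict_apply (hm measurableSet_Iic)]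
  rcases lt_or_ge a 0 with ha | ha
  · have e1 : (fun u => ((hitTime lam f u).toNNReal : ℝ)) ⁻¹' Set.Iic a = ∅ := by
      ext u
      simp only [Set.mem_preimage, Set.mem_Iic, Set.mem_empty_iff_false, iff_false, not_le]
      exact ha.trans_le (NNReal.coe_nonneg _)
    have e2 : Set.Iic a ∩ Set.Ioc (0 : ℝ) t = ∅ := by
      ext s
      simp only [Set.mem_inter_iff, Set.mem_Iic, Set.mem_Ioc, Set.mem_empty_iff_false, iff_false]
      rintro ⟨h1, h2, -⟩
      linarith
    simp [e1, e2]
  · lift a to ℝ≥0 using ha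
    have e1 : (fun u => ((hitTime lam f u).toNNReal : ℝ)) ⁻¹' Set.Iic (a : ℝ) ∩
        Set.Ioc 0 (cumRate lam f t) = Set.Ioc 0 (cumRate lam f (min a t)) := by
      ext u
      simp only [Set.mem_inter_iff, Set.mem_preimage, Set.mem_Iic, Set.mem_Ioc,
        NNReal.coe_le_coe]
      have key : u ≤ cumRate lam f t →
          ((hitTime lam f u).toNNReal ≤ a ↔ u ≤ cumRate lam f a) := by
        intro hu
        have hfin : hitTime lam f u ≠ ⊤ :=
          (((hitTime_le_iff hf lam u t).2 hu).trans_lt ENNReal.coe_lt_top).ne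
        rw [← hitTime_le_iff hf lam u a, ← ENNReal.coe_le_coe, ENNReal.coe_toNNReal hfin]
      rw [(monotone_cumRate hf lam).map_min, le_min_iff]
      constructor
      · rintro ⟨h1, h2, h3⟩
        exact ⟨h2, (key h3).1 h1, h3⟩
      · rintro ⟨h1, h2, h3⟩
        exact ⟨(key h3).2 h2, h1, h3⟩
    have e2 : Set.Iic (a : ℝ) ∩ Set.Ioc (0 : ℝ) t = Set.Ioc (0 : ℝ) ((min a t : ℝ≥0) : ℝ) := by
      ext s
      simp only [Set.mem_inter_iff, Set.mem_Iic, Set.mem_Ioc, NNReal.coe_min, le_min_iff]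
      tauto
    rw [e1, e2, hlint, Real.volume_Ioc, sub_zero]

/-- A job arriving at time `s` is still present at `t` with probability `exp (-κ ∫ₛᵗ μ)`.
Substituting the arrival time for the Poisson level turns `du` into `λ ds`, even where the
cumulative rate is flat and has no inverse. -/
lemma integral_retention_systemSet (hf : IsCadlag f) (lam kap mu : E → ℝ≥0) (t : ℝ≥0) :
    ∫ u in (0 : ℝ)..(cumRate lam f t), retention (systemSet lam kap mu f t) u
      = phi lam kap mu t f := by
  have hfm := hf.measurable
  have hfit : Measurable (hitTime lam f) :=
    ((isBackgroundProcess_const hf).measurable_hitTime lam).comp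
      ((measurable_const (a := ())).prodMk measurable_id)
  set g : ℝ → ℝ := fun s => Real.exp (-((kap (f s.toNNReal) : ℝ) *
    ∫ r in s..(t : ℝ), (mu (f r.toNNReal) : ℝ))) with hg
  have hgm : Measurable g := by
    have h := measurable_phi_integrand hfm (fun _ => 1) kap mu t
    simpa [hg] using h
  have hm : Measurable (fun u => ((hitTime lam f u).toNNReal : ℝ)) :=
    hfit.ennreal_toNNReal.coe_nnreal_real
  have hL0 : 0 ≤ cumRate lam f t := integral_comp_path_nonneg f lam t.coe_nonneg
  calc ∫ u in (0 : ℝ)..(cumRate lam f t), retention (systemSet lam kap mu f t) u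
      = ∫ u in Set.Ioc 0 (cumRate lam f t), g ((hitTime lam f u).toNNReal : ℝ) := by
        rw [intervalIntegral.integral_of_le hL0]
        refine setIntegral_congr_fun measurableSet_Ioc fun u hu => ?_
        simp only [hg, Real.toNNReal_coe]
        exact retention_systemSet hfm lam kap mu t hu.2
    _ = ∫ s, g s ∂((volume.restrict (Set.Ioc (0 : ℝ) t)).withDensity
          (fun s => (lam (f s.toNNReal) : ℝ≥0∞))) := by
        rw [← map_hitTime hfm hfit t, integral_map hm.aemeasurable hgm.aestronglyMeasurable]
    _ = ∫ s in Set.Ioc (0 : ℝ) t, lam (f s.toNNReal) • g s :=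
        integral_withDensity_eq_integral_smul
          ((measurable_of_finite lam).comp (hfm.comp measurable_real_toNNReal)) g
    _ = phi lam kap mu t f := by
        rw [phi, intervalIntegral.integral_of_le t.coe_nonneg]
        rfl

/-- For a fixed path of the background process, the number of jobs has a Poisson distribution. -/
theorem map_numJobs_fixed_path {Ω : Type*} [MeasurableSpace Ω] {P : Measure Ω}
    [IsProbabilityMeasure P] {e z : ℕ → Ω → ℝ} (h : IsMarkedPoisson P e z) (hf : IsCadlag f)
    (lam kap mu : E → ℝ≥0) (t : ℝ≥0) :
    P.map (fun ω => (numJobs lam kap mu f (fun k => e k ω) (fun k => z k ω) t).toReal) =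
      (poissonMeasure (phi lam kap mu t f).toNNReal).map (fun k : ℕ => (k : ℝ)) := by
  simp only [numJobs_eq_numRetained]
  rw [h.map_numRetained (hf.measurableSet_systemSet lam kap mu t)
    (le_of_mem_systemSet hf.measurable lam kap mu t)
    (integral_comp_path_nonneg f lam t.coe_nonneg), integral_retention_systemSet hf]

end FixedPath

/-! ### The law of the number of jobs -/

section Law

variable {Ω : Type*} [MeasurableSpace Ω] {P : Measure Ω} {e z : ℕ → Ω → ℝ}

lemma IsQueueInput.isMarkedPoisson {E : Type*} [TopologicalSpace E] [MeasurableSpace E]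
    {J : ℝ≥0 → Ω → E} (h : IsQueueInput P J e z) : IsMarkedPoisson P e z :=
  ⟨h.measurable_e, h.measurable_z, h.map_e, h.map_z, h.iIndep⟩

/-- On the space of càdlàg paths with the trace of the product σ-algebra, the number of jobs becomes
a measurable function of the path and the Poisson data, as needed to integrate out the path by
Fubini. -/
lemma isBackgroundProcess_coordinate {E : Type*} [TopologicalSpace E] [MeasurableSpace E] :
    IsBackgroundProcess (fun (s : ℝ≥0) (p : {f : ℝ≥0 → E // IsCadlag f}) => p.1 s) :=
  ⟨fun s => (measurable_pi_apply s).comp measurable_subtype_coe, fun p => p.2⟩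

lemma measurable_poissonMeasure_apply (n : ℕ) (S : Set ℕ) :
    Measurable (fun γ : ℝ => poissonMeasure (n * γ.toNNReal) S) := by
  have h : ∀ γ : ℝ, poissonMeasure (n * γ.toNNReal) S
      = ∑' k : ℕ, S.indicator (fun k => poissonMeasure (n * γ.toNNReal) {k}) k := fun γ =>
    (Measure.tsum_indicator_apply_singleton _ S (MeasurableSet.of_discrete)).symm
  simp_rw [h]
  refine Measurable.tsum fun k => ?_
  by_cases hk : k ∈ S
  · simp only [Set.indicator_of_mem hk, poissonMeasure_singleton]
    fun_prop
  · simp only [Set.indicator_of_notMem hk]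
    exact measurable_const

variable {E : Type*} [Finite E] [MetricSpace E] [MeasurableSpace E] [BorelSpace E]
  {J : ℝ≥0 → Ω → E}

lemma IsQueueInput.measurable_scaled_numJobs (h : IsQueueInput P J e z) (lam kap mu : E → ℝ≥0)
    (t : ℝ≥0) (n : ℕ) : Measurable (fun ω =>
      (numJobs lam kap mu (fun s => J s ω) (fun k => e k ω) (fun k => z k ω) t).toReal / n) := by
  have h1 : Measurable (fun ω => (ω, fun i : ℕ ⊕ ℕ => Sum.elim e z i ω)) :=
    measurable_id.prodMk (measurable_pi_lambda _ fun i => by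
      rcases i with i | i
      · exact h.measurable_e i
      · exact h.measurable_z i)
  exact ((h.background.measurable_numJobs lam kap mu t).comp h1).ennreal_toReal.div_const _

lemma IsQueueInput.exists_ae_paramLaw_mem_Icc (h : IsQueueInput P J e z) (lam kap mu : E → ℝ≥0)
    (t : ℝ≥0) : ∃ C : ℝ, ∀ᵐ γ ∂(paramLaw P J lam kap mu t), γ ∈ Set.Icc 0 C := by
  obtain ⟨M, hM⟩ := exists_bound_finite lam
  refine ⟨M * t, ?_⟩
  refine (ae_map_iff (h.background.measurable_phi lam kap mu t).aemeasurable
    (p := fun γ => γ ∈ Set.Icc (0 : ℝ) (M * t)) measurableSet_Icc).2 ?_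
  exact Eventually.of_forall fun ω => phi_mem_Icc (h.background.cadlag ω).measurable kap mu hM t

variable [IsProbabilityMeasure P]

/-- The law of `Mₙ(t) / n` is a mixture of scaled Poisson distributions. -/
theorem IsQueueInput.scaledLaw_apply (h : IsQueueInput P J e z) (lam kap mu : E → ℝ≥0) (t : ℝ≥0)
    (n : ℕ) {B : Set ℝ} (hB : MeasurableSet B) :
    scaledLaw P J e z lam kap mu t n B = ∫⁻ γ, poissonMeasure (n * γ.toNNReal)
      {k : ℕ | (k : ℝ) / n ∈ B} ∂(paramLaw P J lam kap mu t) := by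
  let X : Ω → {f : ℝ≥0 → E // IsCadlag f} := fun ω => ⟨fun s => J s ω, h.background.cadlag ω⟩
  let Y : Ω → (ℕ ⊕ ℕ → ℝ) := fun ω i => Sum.elim e z i ω
  have hX : Measurable X :=
    Measurable.subtype_mk (measurable_pi_lambda _ h.background.measurable)
  have hY : Measurable Y := measurable_pi_lambda _ fun i => by
    rcases i with i | i
    · exact h.measurable_e i
    · exact h.measurable_z i
  have hind : IndepFun X Y P := by
    have := h.indep
    rw [IndepFun_iff_Indep] at this ⊢
    -- Restricting to the space of càdlàg paths does not change the σ-algebra generated by the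
    -- process, so independence is inherited.
    have e1 : MeasurableSpace.comap X inferInstance
        = MeasurableSpace.comap (fun ω (s : ℝ≥0) => J s ω) inferInstance :=
      MeasurableSpace.comap_comp
    rw [e1]
    exact this
  let lam' : E → ℝ≥0 := fun x => (n : ℝ≥0) * lam x
  let A : Set ({f : ℝ≥0 → E // IsCadlag f} × (ℕ ⊕ ℕ → ℝ)) := {p | (numJobs lam' kap mu p.1.1
    (fun k => p.2 (Sum.inl k)) (fun k => p.2 (Sum.inr k)) t).toReal / n ∈ B}
  have hA : MeasurableSet A :=
    ((isBackgroundProcess_coordinate.measurable_numJobs lam' kap mu t).ennreal_toReal.div_const _) hB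
  have hlaw := (indepFun_iff_map_prod_eq_prod_map_map hX.aemeasurable hY.aemeasurable).1 hind
  have hfix : ∀ ω, P.map Y (Prod.mk (X ω) ⁻¹' A) = poissonMeasure
      (n * (phi lam kap mu t (fun s => J s ω)).toNNReal) {k : ℕ | (k : ℝ) / n ∈ B} := by
    intro ω
    have hBn : MeasurableSet {x : ℝ | x / n ∈ B} := (measurable_id.div_const (n : ℝ)) hB
    have h1 := map_numJobs_fixed_path h.isMarkedPoisson (h.background.cadlag ω) lam' kap mu t
    have h2 := congrArg (fun m : Measure ℝ => m {x : ℝ | x / n ∈ B}) h1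
    have hm : Measurable (fun ω' => (numJobs lam' kap mu (fun s => J s ω) (fun k => e k ω')
        (fun k => z k ω') t).toReal) := by
      simp only [numJobs_eq_numRetained]
      exact (measurable_numRetained ((h.background.cadlag ω).measurableSet_systemSet lam' kap mu t)
        h.measurable_e h.measurable_z).ennreal_toReal
    rw [Measure.map_apply hm hBn, Measure.map_apply (by fun_prop) hBn, phi_const_mul,
      Real.toNNReal_mul (NNReal.coe_nonneg _), Real.toNNReal_coe] at h2
    rw [Measure.map_apply hY (measurable_prodMk_left hA)]
    exact h2
  have hφ := h.background.measurable_phi lam kap mu t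
  calc scaledLaw P J e z lam kap mu t n B
      = P ((fun ω => (X ω, Y ω)) ⁻¹' A) :=
        Measure.map_apply (h.measurable_scaled_numJobs lam' kap mu t n) hB
    _ = ((P.map X).prod (P.map Y)) A := by rw [← hlaw, Measure.map_apply (hX.prodMk hY) hA]
    _ = ∫⁻ p, P.map Y (Prod.mk p ⁻¹' A) ∂(P.map X) := Measure.prod_apply hA
    _ = ∫⁻ ω, P.map Y (Prod.mk (X ω) ⁻¹' A) ∂P :=
        lintegral_map (measurable_measure_prodMk_left hA) hX
    _ = ∫⁻ ω, poissonMeasure (n * (phi lam kap mu t (fun s => J s ω)).toNNReal)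
          {k : ℕ | (k : ℝ) / n ∈ B} ∂P := lintegral_congr hfix
    _ = _ := (lintegral_map (measurable_poissonMeasure_apply n _) hφ).symm

lemma IsQueueInput.isProbabilityMeasure_paramLaw (h : IsQueueInput P J e z) (lam kap mu : E → ℝ≥0)
    (t : ℝ≥0) : IsProbabilityMeasure (paramLaw P J lam kap mu t) :=
  Measure.isProbabilityMeasure_map (h.background.measurable_phi lam kap mu t).aemeasurable

/-- The large deviations principle for the number of jobs in a single modulated queue. -/
theorem IsQueueInput.satisfiesLDP_scaledLaw (h : IsQueueInput P J e z) (lam kap mu : E → ℝ≥0)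
    (t : ℝ≥0) {ψ : ℝ → ℝ≥0∞} (hψ : SatisfiesLDP (fun _ => paramLaw P J lam kap mu t) ψ) :
    SatisfiesLDP (scaledLaw P J e z lam kap mu t)
        (rateI (fun _ => paramLaw P J lam kap mu t) ψ) ∧
      IsGoodRateFunction (rateI (fun _ => paramLaw P J lam kap mu t) ψ) := by
  have hprob := h.isProbabilityMeasure_paramLaw lam kap mu t
  obtain ⟨C, hC⟩ := h.exists_ae_paramLaw_mem_Icc lam kap mu t
  have hR := isCompact_attainable_const hC
  rw [show rateI (fun _ => paramLaw P J lam kap mu t) ψ = _ from funext (rateI_const hψ)]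
  refine ⟨satisfiesLDP_mixture hC (fun n => ?_) (fun n _ B hB => h.scaledLaw_apply lam kap mu t n hB)
    hR, isGoodRateFunction_iInf_ell hR⟩
  have : IsProbabilityMeasure (scaledLaw P J e z lam kap mu t n) :=
    Measure.isProbabilityMeasure_map (μ := P) (h.measurable_scaled_numJobs (fun x => (n : ℝ≥0) * lam x) kap mu t n).aemeasurable
  exact prob_le_one

end Law

end ModulatedQueue

/-! ### The main theorem -/

theorem mainTheorem6 {E : Type*} [Fintype E] [DecidableEq E] [MetricSpace E] [MeasurableSpace E]
    [BorelSpace E] (lam kap mu : E → ℝ≥0) (t : ℝ≥0)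
    {Ω₁ : Type*} [MeasurableSpace Ω₁] (P₁ : Measure Ω₁) [IsProbabilityMeasure P₁]
    (J₁ : ℝ≥0 → Ω₁ → E) (e₁ z₁ : ℕ → Ω₁ → ℝ)
    (h₁ : ModulatedQueue.IsQueueInput P₁ J₁ e₁ z₁)
    {Ω₂ : Type*} [MeasurableSpace Ω₂] (P₂ : Measure Ω₂) [IsProbabilityMeasure P₂]
    (J₂ : ℝ≥0 → Ω₂ → E) (e₂ z₂ : ℕ → Ω₂ → ℝ)
    (h₂ : ModulatedQueue.IsQueueInput P₂ J₂ e₂ z₂)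
    (hJ₂ : ModulatedQueue.IsIrreducibleMarkovChain P₂ J₂) :
    let ν₁ : ℕ → Measure ℝ := fun _ => ModulatedQueue.paramLaw P₁ J₁ lam kap mu t
    let ν₂ : ℕ → Measure ℝ := fun _ => ModulatedQueue.paramLaw P₂ J₂ lam kap mu t
    (∃ ψ₁, ModulatedQueue.SatisfiesLDP ν₁ ψ₁) ∧ (∃ ψ₂, ModulatedQueue.SatisfiesLDP ν₂ ψ₂) ∧
    ∀ ψ₁ ψ₂ : ℝ → ℝ≥0∞,
      ModulatedQueue.SatisfiesLDP ν₁ ψ₁ → ModulatedQueue.SatisfiesLDP ν₂ ψ₂ →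
      ModulatedQueue.SatisfiesLDP
          (ModulatedQueue.scaledLaw P₁ J₁ e₁ z₁ lam kap mu t) (ModulatedQueue.rateI ν₁ ψ₁) ∧
      ModulatedQueue.SatisfiesLDP
          (ModulatedQueue.scaledLaw P₂ J₂ e₂ z₂ lam kap mu t) (ModulatedQueue.rateI ν₂ ψ₂) ∧
      (∀ a : ℝ, ModulatedQueue.rateI ν₂ ψ₂ a ≤ ModulatedQueue.rateI ν₁ ψ₁ a) ∧
      ModulatedQueue.IsGoodRateFunction (ModulatedQueue.rateI ν₁ ψ₁) ∧
      ModulatedQueue.IsGoodRateFunction (ModulatedQueue.rateI ν₂ ψ₂) := by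
  intro ν₁ ν₂
  have hp₁ := h₁.isProbabilityMeasure_paramLaw lam kap mu t
  have hp₂ := h₂.isProbabilityMeasure_paramLaw lam kap mu t
  refine ⟨⟨_, ModulatedQueue.satisfiesLDP_const _⟩, ⟨_, ModulatedQueue.satisfiesLDP_const _⟩,
    fun ψ₁ ψ₂ hψ₁ hψ₂ => ?_⟩
  obtain ⟨hldp₁, hgood₁⟩ := h₁.satisfiesLDP_scaledLaw lam kap mu t hψ₁
  obtain ⟨hldp₂, hgood₂⟩ := h₂.satisfiesLDP_scaledLaw lam kap mu t hψ₂
  refine ⟨hldp₁, hldp₂, fun a => ?_, hgood₁, hgood₂⟩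
  rw [ModulatedQueue.rateI_const hψ₁, ModulatedQueue.rateI_const hψ₂]
  exact biInf_mono (ModulatedQueue.attainable_subset_of_isIrreducibleMarkovChain hJ₂ h₂.background
    h₁.background lam kap mu t)
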